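/- **Setting.** Work over a coordinate domain $U$ (coordinates $x^\lambda$, $\lambda=0,\dots,3$) of a 4-dimensional spacetime with a fixed background: a smooth tetrad, with Lorentz metric $g$ and volume form $\eta=\sqrt{|g|}\,d^4x$, Dirac matrices $\gamma^\lambda$, and a linear connection $\Gamma_\lambda$ of the Dirac bundle. Let $\mathfrak L$ be a Lie algebra of anti-Hermitian endomorphisms of a finite-dimensional Hermitian space, $(\mathfrak l_I)$ an orthonormal frame of $\mathfrak L$ for the scalar product $\mathrm{Tr}(X^\dagger Y)$, and $[\mathfrak l_J,\mathfrak l_H]=c^I{}_{JH}\,\mathfrak l_I$. The fields are $A^I_\lambda$, $n_I$ (even) and $\psi^{\alpha i}$, $\bar\psi_{\alpha i}$, $\omega^I$, $\bar\omega_I$ (odd); indices $I$ are raised and lowered by the Euclidean metric of the frame. Fiber polynomials are supercommutative polynomials in the jet coordinates $y^i_\Lambda$ of the fields, with coefficients smooth on $U$ and with values in a supercommutative algebra $\mathcal O$ of constants (freely generated by even and odd generators); $d_\lambda$ is the total derivative, $d_H$ the horizontal differential, $\vec\partial{}_i^\Lambda$ the left partial derivatives ($\vec\partial{}_i^{\lambda_1\cdots\lambda_r}$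 denotes them normalized so as to be symmetric, with $\sum_{\lambda_1,\dots,\lambda_r}d_{\lambda_1\cdots\lambda_r}v^i\,\vec\partial{}_i^{\lambda_1\cdots\lambda_r}=\sum_{|\Lambda|=r}d_\Lambda v^i\,\vec\partial{}_i^\Lambda$), and $dx_\lambda=\partial x_\lambda\rfloor d^4x$. For $v=v^i\partial y_i$, $\delta[v]$ acts on totally horizontal forms coefficientwise as $\sum d_\Lambda v^i\,\vec\partial{}_i^\Lambda$. Let $\omega^I_{;\lambda}=\omega^I_{,\lambda}+c^I{}_{JH}\,\omega^J A^H_\lambda$ and let $\breve v$ have the components $$\breve v^{\alpha i}=\mathfrak l_I{}^i{}_j\,\omega^I\psi^{\alpha j},\quad \breve v_{\alpha i}=\mathfrak l_I{}^j{}_i\,\bar\psi_{\alpha j}\,\omega^I,\quad \breve v^I_\lambda=\omega^I_{;\lambda},\quad \breve v^I=\tfrac12c^I{}_{JH}\,\omega^J\omega^H,\quad \breve v_I=n_I$$ in the sectors $\psi,\bar\psi,A,\omega,\bar\omega$, and $0$ in the sector $n$. The BRST transformation $S$ is defined by $\delta[\theta\breve v]=\theta S$ for odd $\theta\in\mathcal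 O$, i.e. $S=\sum d_\Lambda\breve v^i\,\vec\partial{}_i^\Lambda$. Let $\mathcal L_0=(\ell_\psi+\ell_A)\,d^4x$ with $$\ell_\psi=\bigl(\tfrac{i}{2}(\bar\psi_{\alpha i}\,(\gamma^\lambda\nabla_\lambda\psi)^{\alpha i}-(\nabla_\lambda\bar\psi\,\gamma^\lambda)_{\alpha i}\,\psi^{\alpha i})-m\,\bar\psi_{\alpha i}\psi^{\alpha i}\bigr)\sqrt{|g|},\qquad \ell_A=-\tfrac14g^{\lambda\mu}g^{\nu\rho}F_{\lambda\nu}{}^IF_{\mu\rho I}\sqrt{|g|},$$ where $\nabla_\lambda\psi=\partial_\lambda\psi-\Gamma_\lambda\psi-A^I_\lambda\mathfrak l_I\psi$, $\nabla_\lambda\bar\psi$ is the dual expression, and $F_{\lambda\mu}{}^I=A^I_{\lambda,\mu}-A^I_{\mu,\lambda}+c^I{}_{JH}A^J_\lambda A^H_\mu$. For $\xi\in\mathbb R$ put $f^I=\frac1{\sqrt{|g|}}\,d_\lambda(g^{\lambda\mu}\sqrt{|g|}\,A^I_\mu)$, and let the antifield map $\sigma$ have the only non-zero components $\tilde A^\lambda_I=-g^{\lambda\mu}\bar\omega_{I,\mu}$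 and $\tilde{\bar\omega}{}^I=f^I+\tfrac12\xi n^I$. Let $$\mathcal K=\bar\omega_I(f^I+\tfrac12\xi n^I)\sqrt{|g|}\,d^4x,\qquad \mathcal M=g^{\lambda\mu}\sqrt{|g|}\,\bar\omega_I\,\omega^I_{;\mu}\,dx_\lambda .$$ A $k$-order Lagrangian $\mathcal L=\ell\,d^4x$ is *invariant* under $v$ if $\delta[v]\mathcal L=d_H\mathcal N$ for some $\mathcal N=\mathcal N^\lambda dx_\lambda$ of order $\le k$; the corresponding Noether current is $\mathcal J=(v_{(k-1)}|\mathcal P^\lambda-\mathcal N^\lambda)\,dx_\lambda$ with $$v_{(k-1)}|\mathcal P^\lambda=\sum_{p+r\le k-1}(-1)^r\,d_{\mu_1\cdots\mu_p}v^i\;d_{\nu_1\cdots\nu_r}\vec\partial{}_i^{\lambda\mu_1\cdots\mu_p\nu_1\cdots\nu_r}\ell ,$$ which for $k=2$ is $v^i(\vec\partial{}_i^\lambda\ell-d_\mu\vec\partial{}_i^{\lambda\mu}\ell)+d_\mu v^i\,\vec\partial{}_i^{\lambda\mu}\ell$. **Theorem.** 1. $S$ is an odd anti-derivation with $S y^i=\breve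 v^i$, vanishing on functions of $x$ and commuting with $d_\lambda$; $\delta[\theta\breve v]\alpha=\theta\,S\alpha$ for every odd $\theta\in\mathcal O$ and every totally horizontal form $\alpha$; and $S^2=0$ on fiber polynomials and on totally horizontal forms. 2. $S\mathcal L_0=0$. 3. The ghost Lagrangian $\mathcal L_{\rm ghost}=(\breve v\circ\sigma)\,\eta=(S y^i)\,\sigma_i\,\eta$ satisfies $$\mathcal L_{\rm ghost}=\bigl((SA^I_\lambda)\tilde A^\lambda_I+(S\bar\omega_I)\tilde{\bar\omega}{}^I\bigr)\eta=\bigl(g^{\lambda\mu}\bar\omega_{I,\lambda}\,\omega^I_{;\mu}+n_I(f^I+\tfrac12\xi n^I)\bigr)\eta=S\mathcal K+d_H\mathcal M .$$ 4. Let $v=\theta\breve v$ with $\theta\in\mathcal O$ odd, or $v=\breve v$ (with $\theta$ eliminated). For every $k\ge2$, every Lagrangian $\mathcal L$ of order $\le k$ and every $c\in\mathbb C$, the Lagrangian $\mathcal L+c\,d_H\mathcal M$ is of order $\le k$ and is invariant under $v$ if and only if $\mathcal L$ is; if $\delta[v]\mathcal L=d_H\mathcal N$, then $\delta[v](\mathcal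 L+c\,d_H\mathcal M)=d_H(\mathcal N+c\,\delta[v]\mathcal M)$, and the corresponding two Noether currents coincide. In particular $\mathcal L_0+\mathcal L_{\rm ghost}$ (of order $\le 1$, with $\mathcal N=\delta[v]\mathcal M$, of order $\le1$) and $\mathcal L_0+S\mathcal K$ (of order $\le 2$, with $\mathcal N=0$) are both invariant and have the same current. -/

import Mathlib

open scoped TensorProduct ContDiff Matrix BigOperators
open Finset

noncomputable section

namespace BRST

/-! ## Smooth coefficient functions on a coordinate domain of spacetime -/

/-- Spacetime coordinates `(x⁰, x¹, x², x³)`. -/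
abbrev Pt := Fin 4 → ℝ

/-- Extension by zero of a function given on the coordinate domain. -/
def ext {U : TopologicalSpace.Opens Pt} (f : U → ℂ) : Pt → ℂ :=
  Function.extend Subtype.val f 0

theorem ext_apply {U : TopologicalSpace.Opens Pt} (f : U → ℂ) (x : U) : ext f x = f x :=
  Subtype.val_injective.extend_apply f 0 x

/-- The algebra `C^∞(U, ℂ)`. -/
def Smooth (U : TopologicalSpace.Opens Pt) : Subalgebra ℂ (U → ℂ) where
  carrier := {f | ContDiffOn ℝ ∞ (ext f) U}
  mul_mem' {f g} hf hg := (hf.mul hg).congr fun x hx => by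
    simpa using (ext_apply (f * g) ⟨x, hx⟩).trans
      (by rw [Pi.mul_apply, ← ext_apply f, ← ext_apply g])
  add_mem' {f g} hf hg := (hf.add hg).congr fun x hx => by
    simpa using (ext_apply (f + g) ⟨x, hx⟩).trans
      (by rw [Pi.add_apply, ← ext_apply f, ← ext_apply g])
  algebraMap_mem' c := (contDiffOn_const (c := c)).congr fun x hx => by
    simpa using ext_apply (algebraMap ℂ (U → ℂ) c) ⟨x, hx⟩

variable {U : TopologicalSpace.Opens Pt}

theorem Smooth.differentiableAt (f : Smooth U) (x : U) : DifferentiableAt ℝ (ext f.1) x :=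
  (f.2.contDiffAt (U.isOpen.mem_nhds x.2)).differentiableAt (by simp)

/-- A smooth real function on the coordinate domain, as an element of `C^∞(U, ℂ)`. -/
def Smooth.ofReal (f : Pt → ℝ) (hf : ContDiffOn ℝ ∞ f U) : Smooth U :=
  ⟨fun x => (f x : ℂ), (Complex.ofRealCLM.contDiff.comp_contDiffOn hf).congr fun x hx => by
    simpa using ext_apply (fun y : U => (f y : ℂ)) ⟨x, hx⟩⟩

/-- The partial derivative `∂/∂x^l` on `C^∞(U, ℂ)`. -/
def Smooth.partialD (l : Fin 4) : Smooth U →ₗ[ℂ] Smooth U where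
  toFun f := ⟨fun x => fderiv ℝ (ext f.1) x (Pi.single l 1),
    ((f.2.fderiv_of_isOpen (m := ∞) U.isOpen (by simp)).clm_apply
      contDiffOn_const).congr fun x hx => by
        simpa using ext_apply (fun y : U => fderiv ℝ (ext f.1) y (Pi.single l 1)) ⟨x, hx⟩⟩
  map_add' f g := by
    ext x
    have h : ext (f + g : Smooth U).1 =ᶠ[nhds (x : Pt)] ext f.1 + ext g.1 := by
      filter_upwards [U.isOpen.mem_nhds x.2] with y hy
      have h1 := ext_apply (f + g : Smooth U).1 ⟨y, hy⟩
      have h2 := ext_apply f.1 ⟨y, hy⟩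
      have h3 := ext_apply g.1 ⟨y, hy⟩
      simp only at h1 h2 h3
      rw [h1, Pi.add_apply, h2, h3]; rfl
    change fderiv ℝ (ext (f + g : Smooth U).1) x _ = fderiv ℝ (ext f.1) x _ +
      fderiv ℝ (ext g.1) x _
    rw [h.fderiv_eq, fderiv_add (Smooth.differentiableAt f x) (Smooth.differentiableAt g x)]; rfl
  map_smul' c f := by
    ext x
    have h : ext (c • f : Smooth U).1 =ᶠ[nhds (x : Pt)] c • ext f.1 := by
      filter_upwards [U.isOpen.mem_nhds x.2] with y hy
      have h1 := ext_apply (c • f : Smooth U).1 ⟨y, hy⟩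
      have h2 := ext_apply f.1 ⟨y, hy⟩
      simp only at h1 h2
      rw [h1, Pi.smul_apply, h2]; rfl
    change fderiv ℝ (ext (c • f : Smooth U).1) x _ = c • fderiv ℝ (ext f.1) x _
    rw [h.fderiv_eq, fderiv_const_smul (Smooth.differentiableAt f x)]; rfl

/-! ## Classical background data -/

/-- An orthonormal frame `(𝔩_I)` of a Lie algebra `𝔏` of anti-Hermitian endomorphisms of the
Hermitian internal space `ℂ^κ`; orthonormality refers to the scalar product `Tr(X† Y)`. -/
structure GaugeFrame (ι κ : Type) [DecidableEq ι] [Fintype κ] where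
  /-- the matrices `𝔩_I = (𝔩_I ^i _j)` -/
  mat : ι → Matrix κ κ ℂ
  antiHermitian : ∀ I, (mat I)ᴴ = -mat I
  orthonormal : ∀ I J, Matrix.trace ((mat I)ᴴ * mat J) = if I = J then 1 else 0
  bracket_mem : ∀ J H, mat J * mat H - mat H * mat J ∈ Submodule.span ℝ (Set.range mat)

/-- The structure constants `c^I_{JH} = ⟨𝔩^I, [𝔩_J, 𝔩_H]⟩`; the dual frame is given by the
scalar product `Tr(X† Y)`, since the frame is orthonormal. -/
def GaugeFrame.c {ι κ : Type} [DecidableEq ι] [Fintype κ] (G : GaugeFrame ι κ) (I J H : ι) : ℂ :=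
  Matrix.trace ((G.mat I)ᴴ * (G.mat J * G.mat H - G.mat H * G.mat J))

/-- The Minkowski matrix `diag(1, -1, -1, -1)`. -/
def minkowski : Matrix (Fin 4) (Fin 4) ℝ := Matrix.diagonal ![1, -1, -1, -1]

/-- A fixed gravitational background on a coordinate domain: a tetrad, the Dirac matrices, and a
linear connection of the Dirac spinor bundle. -/
structure Background (U : TopologicalSpace.Opens Pt) where
  /-- tetrad components: `tetrad x a l` is `Θ^a_l(x)` -/
  tetrad : Pt → Matrix (Fin 4) (Fin 4) ℝ
  tetrad_smooth : ∀ a l, ContDiffOn ℝ ∞ (fun x => tetrad x a l) U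
  tetrad_det : ∀ x ∈ U, (tetrad x).det ≠ 0
  /-- the constant Dirac matrices `γ^a` -/
  gamma : Fin 4 → Matrix (Fin 4) (Fin 4) ℂ
  clifford : ∀ a b, gamma a * gamma b + gamma b * gamma a =
    ((2 * minkowski a b : ℝ) : ℂ) • (1 : Matrix (Fin 4) (Fin 4) ℂ)
  /-- spinor connection coefficients: `spinConn l α β` is `Γ_l^α_β` -/
  spinConn : Fin 4 → Fin 4 → Fin 4 → Smooth U

namespace Background

variable (B : Background U)

/-- The spacetime metric `g_{lm} = η_{ab} Θ^a_l Θ^b_m`. -/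
def metric (x : Pt) : Matrix (Fin 4) (Fin 4) ℝ := (B.tetrad x)ᵀ * minkowski * B.tetrad x

theorem metric_det (x : Pt) : (B.metric x).det = -((B.tetrad x).det ^ 2) := by
  simp [metric, minkowski, Matrix.det_mul, Fin.prod_univ_four]
  ring

theorem smooth_det {M : Pt → Matrix (Fin 4) (Fin 4) ℝ}
    (hM : ∀ a l, ContDiffOn ℝ ∞ (fun x => M x a l) U) : ContDiffOn ℝ ∞ (fun x => (M x).det) U := by
  simp only [Matrix.det_apply]
  refine ContDiffOn.sum fun s _ => ContDiffOn.const_smul _ (contDiffOn_prod fun i _ => hM _ _)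

theorem smooth_inv {M : Pt → Matrix (Fin 4) (Fin 4) ℝ}
    (hM : ∀ a l, ContDiffOn ℝ ∞ (fun x => M x a l) U) (h0 : ∀ x ∈ U, (M x).det ≠ 0)
    (a l : Fin 4) : ContDiffOn ℝ ∞ (fun x => (M x)⁻¹ a l) U := by
  simp only [Matrix.inv_def, Matrix.smul_apply, Ring.inverse_eq_inv', smul_eq_mul,
    Matrix.adjugate_apply]
  refine ((smooth_det hM).inv h0).mul (smooth_det fun i j => ?_)
  by_cases hi : i = l
  · subst hi
    simpa using contDiffOn_const
  · simpa [Matrix.updateRow_ne hi] using hM i j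

theorem smooth_metric (l m : Fin 4) : ContDiffOn ℝ ∞ (fun x => B.metric x l m) U := by
  simp only [metric, minkowski, Matrix.mul_apply, Matrix.transpose_apply]
  exact ContDiffOn.sum fun i _ => (ContDiffOn.sum fun j _ =>
    (B.tetrad_smooth j l).mul contDiffOn_const).mul (B.tetrad_smooth i m)

theorem metric_det_ne (x : Pt) (hx : x ∈ U) : (B.metric x).det ≠ 0 := by
  rw [metric_det]
  exact neg_ne_zero.2 (pow_ne_zero 2 (B.tetrad_det x hx))

theorem smooth_sqrt : ContDiffOn ℝ ∞ (fun x => √|(B.metric x).det|) U := by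
  simp only [metric_det, abs_neg, abs_pow, sq_abs]
  exact ((smooth_det B.tetrad_smooth).pow 2).sqrt fun x hx => pow_ne_zero 2 (B.tetrad_det x hx)

/-- The inverse metric `g^{lm}`. -/
def gInv (l m : Fin 4) : Smooth U :=
  Smooth.ofReal (fun x => (B.metric x)⁻¹ l m) (smooth_inv B.smooth_metric B.metric_det_ne l m)

/-- The density `√|g|`. -/
def sqrtG : Smooth U := Smooth.ofReal (fun x => √|(B.metric x).det|) B.smooth_sqrt

/-- The function `1/√|g|`. -/
def invSqrtG : Smooth U :=
  Smooth.ofReal (fun x => (√|(B.metric x).det|)⁻¹) (B.smooth_sqrt.inv fun x hx =>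
    (Real.sqrt_pos.2 (abs_pos.2 (B.metric_det_ne x hx))).ne')

/-- The spacetime Dirac matrices `(γ^l)^α_β = (Θ⁻¹)^l_a (γ^a)^α_β`. -/
def gammaUp (l α β : Fin 4) : Smooth U :=
  ∑ a, B.gamma a α β • Smooth.ofReal (fun x => (B.tetrad x)⁻¹ l a)
    (smooth_inv B.tetrad_smooth B.tetrad_det l a)

end Background

/-! ## Fields and fiber polynomials on jet bundles -/

/-- The bosonic components: `A^I_l` and `n_I`. -/
inductive Boson (ι : Type) : Type
  | A (l : Fin 4) (I : ι)
  | n (I : ι)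
  deriving Fintype

/-- The fermionic components: `ψ^{αi}`, `ψ̄_{αi}`, `ω^I` and `ω̄_I`. -/
inductive Fermion (ι κ : Type) : Type
  | psi (α : Fin 4) (i : κ)
  | psiBar (α : Fin 4) (i : κ)
  | omega (I : ι)
  | omegaBar (I : ι)
  deriving Fintype

/-- All linear fiber coordinates `y^i` of the configuration bundle. -/
abbrev Fld (ι κ : Type) := Boson ι ⊕ Fermion ι κ

/-- Multi-indices of spacetime derivatives. -/
abbrev MIdx := Fin 4 → ℕ

/-- Even generators: jet coordinates of bosonic fields, and even generators of the algebra of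
constants. -/
abbrev EvenGen (ι Zb : Type) := Zb ⊕ Boson ι × MIdx

/-- Odd generators: jet coordinates of fermionic fields, and odd generators of the algebra of
constants. -/
abbrev OddGen (ι κ Zf : Type) := Zf ⊕ Fermion ι κ × MIdx

/-- Polynomials in the jet coordinates: symmetric in the even generators, exterior in the odd
ones. The generators `Zb` (even) and `Zf` (odd) are constants; they generate the supercommutative
operator algebra `𝒪 = ∨(Zb) ⊗ ∧(Zf)` in which quantum fields take values. -/
abbrev SPoly (ι κ Zb Zf : Type) :=
  MvPolynomial (EvenGen ι Zb) ℂ ⊗[ℂ] ExteriorAlgebra ℂ (OddGen ι κ Zf →₀ ℂ)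

/-- Fiber polynomials on the jet bundles of the quantum bundle over `U`, with coefficients
depending smoothly on the point of `U`. -/
abbrev FPoly (U : TopologicalSpace.Opens Pt) (ι κ Zb Zf : Type) :=
  Smooth U ⊗[ℂ] SPoly ι κ Zb Zf

variable {ι κ Zb Zf : Type}

instance : Ring (SPoly ι κ Zb Zf) := Algebra.TensorProduct.instRing
instance : Algebra ℂ (SPoly ι κ Zb Zf) := Algebra.TensorProduct.leftAlgebra
instance : Ring (FPoly U ι κ Zb Zf) := Algebra.TensorProduct.instRing
instance : NonUnitalNonAssocSemiring (FPoly U ι κ Zb Zf) :=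
  Algebra.TensorProduct.instNonUnitalNonAssocSemiring
instance : Algebra ℂ (FPoly U ι κ Zb Zf) := Algebra.TensorProduct.leftAlgebra

/-- A smooth function on `U` as a fiber polynomial of degree zero. -/
def coef (s : Smooth U) : FPoly U ι κ Zb Zf := s ⊗ₜ 1

/-- Even generators as fiber polynomials. -/
def evenVar (e : EvenGen ι Zb) : FPoly U ι κ Zb Zf := 1 ⊗ₜ (MvPolynomial.X e ⊗ₜ 1)

/-- Odd generators as fiber polynomials. -/
def oddVar (o : OddGen ι κ Zf) : FPoly U ι κ Zb Zf :=
  1 ⊗ₜ (1 ⊗ₜ ExteriorAlgebra.ι ℂ (Finsupp.single o 1))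

/-- The jet coordinate `y^i_Λ`. -/
def jet : Fld ι κ → MIdx → FPoly U ι κ Zb Zf
  | .inl b, Λ => evenVar (.inr (b, Λ))
  | .inr f, Λ => oddVar (.inr (f, Λ))

/-- The algebra `𝒪` of constants. -/
def constants (U : TopologicalSpace.Opens Pt) (ι κ Zb Zf : Type) :
    Subalgebra ℂ (FPoly U ι κ Zb Zf) :=
  Algebra.adjoin ℂ (Set.range (fun z => evenVar (.inl z)) ∪ Set.range (fun z => oddVar (.inl z)))

/-- The parity involution, `f ↦ (-1)^{|f|} f` on homogeneous elements. -/
def parity : FPoly U ι κ Zb Zf →ₗ[ℂ] FPoly U ι κ Zb Zf :=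
  TensorProduct.map LinearMap.id
    (TensorProduct.map LinearMap.id (CliffordAlgebra.involute (Q := 0)).toLinearMap)

/-- The left partial derivative with respect to the jet coordinate `y^i_Λ`: the usual partial
derivative for an even coordinate, the (left) interior product for an odd one. -/
def pd : Fld ι κ × MIdx → FPoly U ι κ Zb Zf →ₗ[ℂ] FPoly U ι κ Zb Zf
  | (.inl b, Λ) => TensorProduct.map LinearMap.id
      (TensorProduct.map (MvPolynomial.pderiv (.inr (b, Λ))).toLinearMap LinearMap.id)
  | (.inr f, Λ) => TensorProduct.map LinearMap.id
      (TensorProduct.map LinearMap.id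
        (CliffordAlgebra.contractLeft (Q := 0) (Finsupp.lapply (.inr (f, Λ)))))

theorem contract_finite {O : Type} (a : ExteriorAlgebra ℂ (O →₀ ℂ)) :
    {o : O | CliffordAlgebra.contractLeft (Q := 0) (Finsupp.lapply o) a ≠ 0}.Finite := by
  induction a using CliffordAlgebra.left_induction with
  | algebraMap r => simp [CliffordAlgebra.contractLeft_algebraMap]
  | add x y hx hy =>
    refine (hx.union hy).subset fun o ho => ?_
    by_contra h
    simp only [Set.mem_union, Set.mem_ofPred_eq, not_or, not_not] at h
    exact ho (by rw [map_add, h.1, h.2, add_zero])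
  | ι_mul x m hx =>
    refine (hx.union m.support.finite_toSet).subset fun o ho => ?_
    by_contra h
    simp only [Set.mem_union, Set.mem_ofPred_eq, not_or, not_not, Finset.mem_coe,
      Finsupp.notMem_support_iff] at h
    refine ho ?_
    rw [CliffordAlgebra.contractLeft_ι_mul, h.1, mul_zero, sub_zero, Finsupp.lapply_apply, h.2,
      zero_smul]

/-- A fiber polynomial depends on finitely many jet coordinates. -/
theorem pd_finite (f : FPoly U ι κ Zb Zf) : {p | pd p f ≠ 0}.Finite := by
  classical
  induction f using TensorProduct.induction_on with
  | zero => simp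
  | add x y hx hy =>
    refine (hx.union hy).subset fun o ho => ?_
    by_contra h
    simp only [Set.mem_union, Set.mem_ofPred_eq, not_or, not_not] at h
    exact ho (by rw [map_add, h.1, h.2, add_zero])
  | tmul s q =>
    induction q using TensorProduct.induction_on with
    | zero => simp
    | add x y hx hy =>
      refine (hx.union hy).subset fun o ho => ?_
      by_contra h
      simp only [Set.mem_union, Set.mem_ofPred_eq, not_or, not_not] at h
      exact ho (by rw [TensorProduct.tmul_add, map_add, h.1, h.2, add_zero])
    | tmul a b =>
      have hb : {r : Boson ι × MIdx | MvPolynomial.pderiv (.inr r : EvenGen ι Zb) a ≠ 0}.Finite :=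
        (a.vars.finite_toSet.preimage Sum.inr_injective.injOn).subset fun r hr => by
          by_contra h
          exact hr (MvPolynomial.pderiv_eq_zero_of_notMem_vars (by simpa using h))
      have hf := (contract_finite b).preimage
        (f := (Sum.inr : Fermion ι κ × MIdx → OddGen ι κ Zf)) Sum.inr_injective.injOn
      refine ((hb.image fun r => ((.inl r.1 : Fld ι κ), r.2)).union
        (hf.image fun r => ((.inr r.1 : Fld ι κ), r.2))).subset ?_
      rintro ⟨i | i, Λ⟩ hp
      · refine Or.inl ⟨(i, Λ), fun h => hp ?_, rfl⟩
        simp [pd, h]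
      · refine Or.inr ⟨(i, Λ), fun h => hp ?_, rfl⟩
        simp [pd, h]

/-- The operator `f ↦ ∑ w^p ∂f/∂y^p`, the sum being over all jet coordinates `y^p`. -/
def vert (w : Fld ι κ × MIdx → FPoly U ι κ Zb Zf) :
    FPoly U ι κ Zb Zf →ₗ[ℂ] FPoly U ι κ Zb Zf where
  toFun f := ∑ᶠ p, w p * pd p f
  map_add' f g := by
    rw [← finsum_add_distrib]
    · simp only [map_add, mul_add]
    · exact (pd_finite f).subset fun p hp h => hp (by simp [h])
    · exact (pd_finite g).subset fun p hp h => hp (by simp [h])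
  map_smul' c f := by
    simp only [map_smul, mul_smul_comm, RingHom.id_apply]
    rw [smul_finsum' c ((pd_finite f).subset fun p hp h => hp (by simp [h]))]

/-- The total derivative `d_l = ∂_l + ∑ y^i_{Λ+l} ∂/∂y^i_Λ`. -/
def totalD (l : Fin 4) : FPoly U ι κ Zb Zf →ₗ[ℂ] FPoly U ι κ Zb Zf :=
  TensorProduct.map (Smooth.partialD l) LinearMap.id +
    vert fun p => jet p.1 (p.2 + Pi.single l 1)

/-- The iterated total derivative `d_Λ`. -/
def dMulti (Λ : MIdx) : FPoly U ι κ Zb Zf →ₗ[ℂ] FPoly U ι κ Zb Zf :=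
  totalD 0 ^ Λ 0 * totalD 1 ^ Λ 1 * totalD 2 ^ Λ 2 * totalD 3 ^ Λ 3

/-- The action on fiber polynomials of the holonomic prolongation of the vertical field
`v = v^i ∂/∂y^i`, that is `f ↦ ∑ d_Λ v^i ∂f/∂y^i_Λ`. -/
def prolong (v : Fld ι κ → FPoly U ι κ Zb Zf) : FPoly U ι κ Zb Zf →ₗ[ℂ] FPoly U ι κ Zb Zf :=
  vert fun p => dMulti p.2 (v p.1)

/-- `f` only depends on the jet coordinates of order at most `k`. -/
def HasOrder (k : ℕ) (f : FPoly U ι κ Zb Zf) : Prop :=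
  ∀ i : Fld ι κ, ∀ Λ : MIdx, k < ∑ l, Λ l → pd (i, Λ) f = 0

/-! ## Totally horizontal forms -/

/-- Totally horizontal forms of all degrees, with fiber polynomials as coefficients. -/
abbrev HForm (U : TopologicalSpace.Opens Pt) (ι κ Zb Zf : Type) :=
  FPoly U ι κ Zb Zf ⊗[ℂ] ExteriorAlgebra ℂ (Fin 4 → ℂ)

/-- The coordinate `1`-forms `dx^l`. -/
def dx (l : Fin 4) : ExteriorAlgebra ℂ (Fin 4 → ℂ) := ExteriorAlgebra.ι ℂ (Pi.single l 1)

/-- The coordinate volume form `d⁴x = dx⁰ ∧ dx¹ ∧ dx² ∧ dx³`. -/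
def d4x : ExteriorAlgebra ℂ (Fin 4 → ℂ) := dx 0 * dx 1 * dx 2 * dx 3

/-- The `3`-forms `dx_l = ∂x_l ⌋ d⁴x`. -/
def dxLow (l : Fin 4) : ExteriorAlgebra ℂ (Fin 4 → ℂ) :=
  CliffordAlgebra.contractLeft (Q := 0) (LinearMap.proj l) d4x

/-- The horizontal `4`-form `ℓ d⁴x`. -/
def fourForm (ell : FPoly U ι κ Zb Zf) : HForm U ι κ Zb Zf := ell ⊗ₜ d4x

/-- The horizontal `3`-form `N^l dx_l`. -/
def threeForm (N : Fin 4 → FPoly U ι κ Zb Zf) : HForm U ι κ Zb Zf := ∑ l, N l ⊗ₜ dxLow l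

/-- The horizontal differential, `d_H (f τ) = ∑ d_l f dx^l ∧ τ`. -/
def dH : HForm U ι κ Zb Zf →ₗ[ℂ] HForm U ι κ Zb Zf :=
  ∑ l, TensorProduct.map (totalD l) (LinearMap.mulLeft ℂ (dx l))

/-- The operator `δ[v]` on totally horizontal forms: the Lie derivative along the holonomic
prolongation of `v`. -/
def delta (v : Fld ι κ → FPoly U ι κ Zb Zf) : HForm U ι κ Zb Zf →ₗ[ℂ] HForm U ι κ Zb Zf :=
  TensorProduct.map (prolong v) LinearMap.id

/-- Left multiplication of horizontal forms by a fiber polynomial. -/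
def mulForm (f : FPoly U ι κ Zb Zf) : HForm U ι κ Zb Zf →ₗ[ℂ] HForm U ι κ Zb Zf :=
  TensorProduct.map (LinearMap.mulLeft ℂ f) LinearMap.id

/-! ## Symmetries and Noether currents -/

/-- The multi-index of a sequence of spacetime indices. -/
def midx (L : List (Fin 4)) : MIdx := fun l => L.count l

/-- The derivative `∂_i^{l₁…l_r}`, normalized to be symmetric in `l₁ … l_r`: the sum over all
sequences with a given multi-index `Λ` is the derivative with respect to `y^i_Λ`. -/
def symPd (i : Fld ι κ) (L : List (Fin 4)) (f : FPoly U ι κ Zb Zf) : FPoly U ι κ Zb Zf :=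
  ((∏ l, (L.count l).factorial : ℂ) / (L.length.factorial : ℂ)) • pd (i, midx L) f

/-- The components of `v_{(k-1)} | P` for a Lagrangian `ℓ d⁴x` of order at most `k`,
`∑ d_{m₁…m_p} v^i (-1)^r d_{s₁…s_r} ∂_i^{l m₁…m_p s₁…s_r} ℓ` over `p + r ≤ k - 1`.
For `k = 1` it is `v^i ∂_i^l ℓ`, and for `k = 2` it is
`v^i (∂_i^l ℓ - d_m ∂_i^{lm} ℓ) + d_m v^i ∂_i^{lm} ℓ`. -/
def noetherP [Fintype ι] [Fintype κ] (k : ℕ) (v : Fld ι κ → FPoly U ι κ Zb Zf)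
    (ell : FPoly U ι κ Zb Zf) (l : Fin 4) : FPoly U ι κ Zb Zf :=
  ∑ p ∈ range k, ∑ r ∈ range (k - p), ∑ m : Fin p → Fin 4, ∑ s : Fin r → Fin 4, ∑ i,
    dMulti (midx (List.ofFn m)) (v i) * ((-1) ^ r *
      dMulti (midx (List.ofFn s)) (symPd i (l :: (List.ofFn m ++ List.ofFn s)) ell))

/-- `δ[v] (ℓ d⁴x) = d_H (N^l dx_l)`. -/
def SymmetricVia (v : Fld ι κ → FPoly U ι κ Zb Zf) (ell : FPoly U ι κ Zb Zf)
    (N : Fin 4 → FPoly U ι κ Zb Zf) : Prop :=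
  delta v (fourForm ell) = dH (threeForm N)

/-- `v` is an infinitesimal vertical symmetry of the `k`-order Lagrangian `ℓ d⁴x`. -/
def IsSymmetry (k : ℕ) (v : Fld ι κ → FPoly U ι κ Zb Zf) (ell : FPoly U ι κ Zb Zf) : Prop :=
  ∃ N : Fin 4 → FPoly U ι κ Zb Zf, (∀ l, HasOrder k (N l)) ∧ SymmetricVia v ell N

/-- The Noether current `(v_{(k-1)} | P^l - N^l) dx_l`. -/
def current [Fintype ι] [Fintype κ] (k : ℕ) (v : Fld ι κ → FPoly U ι κ Zb Zf)
    (ell : FPoly U ι κ Zb Zf) (N : Fin 4 → FPoly U ι κ Zb Zf) : HForm U ι κ Zb Zf :=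
  threeForm fun l => noetherP k v ell l - N l

/-! ## The gauge theory -/

section Coordinates

variable (U ι κ Zb Zf)

/-- `A^I_l` -/
def fA (l : Fin 4) (I : ι) : FPoly U ι κ Zb Zf := jet (.inl (.A l I)) 0
/-- `n_I`, also `n^I` since the frame is orthonormal -/
def fn (I : ι) : FPoly U ι κ Zb Zf := jet (.inl (.n I)) 0
/-- `ψ^{αi}` -/
def fpsi (α : Fin 4) (i : κ) : FPoly U ι κ Zb Zf := jet (.inr (.psi α i)) 0
/-- `ψ̄_{αi}` -/
def fpsiBar (α : Fin 4) (i : κ) : FPoly U ι κ Zb Zf := jet (.inr (.psiBar α i)) 0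
/-- `ω^I` -/
def fom (I : ι) : FPoly U ι κ Zb Zf := jet (.inr (.omega I)) 0
/-- `ω̄_I` -/
def fomBar (I : ι) : FPoly U ι κ Zb Zf := jet (.inr (.omegaBar I)) 0

end Coordinates

variable [Fintype ι] [DecidableEq ι] [Fintype κ]

/-- `ω^I_{;l} = ω^I_{,l} + c^I_{JH} ω^J A^H_l` -/
def omCov (G : GaugeFrame ι κ) (l : Fin 4) (I : ι) : FPoly U ι κ Zb Zf :=
  totalD l (fom U ι κ Zb Zf I) +
    ∑ J, ∑ H, G.c I J H • (fom U ι κ Zb Zf J * fA U ι κ Zb Zf l H)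

/-- The components of `v̆`. -/
def vBrst (U : TopologicalSpace.Opens Pt) (Zb Zf : Type) (G : GaugeFrame ι κ) :
    Fld ι κ → FPoly U ι κ Zb Zf
  | .inl (.A l I) => omCov G l I
  | .inl (.n _) => 0
  | .inr (.psi α i) => ∑ I, ∑ j, G.mat I i j • (fom U ι κ Zb Zf I * fpsi U ι κ Zb Zf α j)
  | .inr (.psiBar α i) => ∑ I, ∑ j, G.mat I j i • (fpsiBar U ι κ Zb Zf α j * fom U ι κ Zb Zf I)
  | .inr (.omega I) =>
      ∑ J, ∑ H, ((1 / 2 : ℂ) * G.c I J H) • (fom U ι κ Zb Zf J * fom U ι κ Zb Zf H)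
  | .inr (.omegaBar I) => fn U ι κ Zb Zf I

/-- The BRST transformation `S` on fiber polynomials. -/
def brst (U : TopologicalSpace.Opens Pt) (Zb Zf : Type) (G : GaugeFrame ι κ) :
    FPoly U ι κ Zb Zf →ₗ[ℂ] FPoly U ι κ Zb Zf :=
  prolong (vBrst U Zb Zf G)

/-- The BRST transformation `S` on totally horizontal forms. -/
def brstForm (U : TopologicalSpace.Opens Pt) (Zb Zf : Type) (G : GaugeFrame ι κ) :
    HForm U ι κ Zb Zf →ₗ[ℂ] HForm U ι κ Zb Zf :=
  delta (vBrst U Zb Zf G)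

variable (Zb Zf)

/-- The curvature `F_{lm}^I = A^I_{l,m} - A^I_{m,l} + c^I_{JH} A^J_l A^H_m`, for which
`[∇_l, ∇_m] = F_{lm}` where `∇_l = ∂_l - A_l`. -/
def curv (U : TopologicalSpace.Opens Pt) (G : GaugeFrame ι κ) (l m : Fin 4) (I : ι) :
    FPoly U ι κ Zb Zf :=
  totalD m (fA U ι κ Zb Zf l I) - totalD l (fA U ι κ Zb Zf m I) +
    ∑ J, ∑ H, G.c I J H • (fA U ι κ Zb Zf l J * fA U ι κ Zb Zf m H)

/-- `∇_l ψ^{αi} = ψ^{αi}_{,l} - Γ_l^α_β ψ^{βi} - A^I_l 𝔩_I^i_j ψ^{αj}` -/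
def covPsi (B : Background U) (G : GaugeFrame ι κ) (l α : Fin 4) (i : κ) : FPoly U ι κ Zb Zf :=
  totalD l (fpsi U ι κ Zb Zf α i) -
    ∑ β, coef (B.spinConn l α β) * fpsi U ι κ Zb Zf β i -
    ∑ I, ∑ j, G.mat I i j • (fA U ι κ Zb Zf l I * fpsi U ι κ Zb Zf α j)

/-- `∇_l ψ̄_{αi} = ψ̄_{αi,l} + ψ̄_{βi} Γ_l^β_α + ψ̄_{αj} 𝔩_I^j_i A^I_l` -/
def covPsiBar (B : Background U) (G : GaugeFrame ι κ) (l α : Fin 4) (i : κ) : FPoly U ι κ Zb Zf :=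
  totalD l (fpsiBar U ι κ Zb Zf α i) +
    ∑ β, fpsiBar U ι κ Zb Zf β i * coef (B.spinConn l β α) +
    ∑ I, ∑ j, G.mat I j i • (fpsiBar U ι κ Zb Zf α j * fA U ι κ Zb Zf l I)

/-- The Dirac operator, `(∇̸ψ)^{αi} = (γ^l)^α_β ∇_l ψ^{βi}`. -/
def slashPsi (B : Background U) (G : GaugeFrame ι κ) (α : Fin 4) (i : κ) : FPoly U ι κ Zb Zf :=
  ∑ l, ∑ β, coef (B.gammaUp l α β) * covPsi Zb Zf B G l β i

/-- The Dirac operator on the conjugate field, `(∇̸ψ̄)_{αi} = ∇_l ψ̄_{βi} (γ^l)^β_α`. -/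
def slashPsiBar (B : Background U) (G : GaugeFrame ι κ) (α : Fin 4) (i : κ) : FPoly U ι κ Zb Zf :=
  ∑ l, ∑ β, covPsiBar Zb Zf B G l β i * coef (B.gammaUp l β α)

/-- The matter Lagrangian `ℓ_ψ`, with mass `mass`. -/
def ellPsi (B : Background U) (G : GaugeFrame ι κ) (mass : ℝ) : FPoly U ι κ Zb Zf :=
  (∑ α, ∑ i, ((Complex.I / 2) • (fpsiBar U ι κ Zb Zf α i * slashPsi Zb Zf B G α i -
      slashPsiBar Zb Zf B G α i * fpsi U ι κ Zb Zf α i) -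
    (mass : ℂ) • (fpsiBar U ι κ Zb Zf α i * fpsi U ι κ Zb Zf α i))) * coef B.sqrtG

/-- The gauge field Lagrangian `ℓ_A = -¼ g^{lm} g^{pq} F_{lp}^I F_{mq I} √|g|`. -/
def ellA (B : Background U) (G : GaugeFrame ι κ) : FPoly U ι κ Zb Zf :=
  (-(1 / 4 : ℂ)) • ∑ l, ∑ m, ∑ p, ∑ q, ∑ I,
    coef (B.gInv l m * B.gInv p q * B.sqrtG) * (curv Zb Zf U G l p I * curv Zb Zf U G m q I)

/-- The coefficient of the matter and gauge field Lagrangian `𝓛₀`. -/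
def ell0 (B : Background U) (G : GaugeFrame ι κ) (mass : ℝ) : FPoly U ι κ Zb Zf :=
  ellPsi Zb Zf B G mass + ellA Zb Zf B G

variable (κ)

/-- `f^I = (1/√|g|) d_l (g^{lm} √|g| A^I_m)` -/
def gaugeF (B : Background U) (I : ι) : FPoly U ι κ Zb Zf :=
  coef B.invSqrtG * ∑ l, totalD l (∑ m, coef (B.gInv l m * B.sqrtG) * fA U ι κ Zb Zf m I)

/-- `f^I + ½ ξ n^I` -/
def gaugeFix (B : Background U) (ξ : ℝ) (I : ι) : FPoly U ι κ Zb Zf :=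
  gaugeF κ Zb Zf B I + ((1 / 2 : ℂ) * (ξ : ℂ)) • fn U ι κ Zb Zf I

/-- The components `σ_i` of the antifield map: `Ã^l_I = -g^{lm} ω̄_{I,m}`, the component in the
antifield sector of `ω̄` is `f^I + ½ ξ n^I`, and the other ones vanish. -/
def antifield (B : Background U) (ξ : ℝ) : Fld ι κ → FPoly U ι κ Zb Zf
  | .inl (.A l I) => -∑ m, coef (B.gInv l m) * totalD m (fomBar U ι κ Zb Zf I)
  | .inl (.n _) => 0
  | .inr (.psi _ _) => 0
  | .inr (.psiBar _ _) => 0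
  | .inr (.omega _) => 0
  | .inr (.omegaBar I) => gaugeFix κ Zb Zf B ξ I

/-- The coefficient of `𝓚 = ω̄_I (f^I + ½ ξ n^I) √|g| d⁴x`. -/
def kCoef (B : Background U) (ξ : ℝ) : FPoly U ι κ Zb Zf :=
  ∑ I, fomBar U ι κ Zb Zf I * gaugeFix κ Zb Zf B ξ I * coef B.sqrtG

variable {κ}

/-- The coefficient of the ghost Lagrangian `(v̆ ∘ σ) η = (∑ (S y^i) σ_i) √|g| d⁴x`. -/
def ellGhost (B : Background U) (G : GaugeFrame ι κ) (ξ : ℝ) : FPoly U ι κ Zb Zf :=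
  (∑ i, vBrst U Zb Zf G i * antifield κ Zb Zf B ξ i) * coef B.sqrtG

/-- The components of `𝓜 = g^{lm} √|g| ω̄_I ω^I_{;m} dx_l`. -/
def mCoef (B : Background U) (G : GaugeFrame ι κ) (l : Fin 4) : FPoly U ι κ Zb Zf :=
  ∑ m, ∑ I, coef (B.gInv l m * B.sqrtG) * (fomBar U ι κ Zb Zf I * omCov G m I)

end BRST

end

noncomputable section

namespace BRST

variable {U : TopologicalSpace.Opens Pt} {ι κ Zb Zf : Type}

/-! ## Fiber polynomials: generators, parity and partial derivatives -/

/-! The partial derivatives `pd`, the total derivatives and the prolongations of homogeneous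
vertical fields are super-derivations of a supercommutative algebra generated by functions on `U`,
constants and jet coordinates. Commutation relations between them therefore need checking on
generators only. In particular the prolongation of a homogeneous `v` commutes with `d_l`, because in
either order a jet coordinate `y^i_Λ` goes to `d_{Λ+l} v^i` (`prolong_totalD`); and the square of an
odd super-derivation is an ordinary derivation, so `S² = 0` reduces to `S v̆ = 0` (`brst_vBrst`).

The gauge computations are done with the matrices `ω = ω^I 𝔩_I` and `A_l = A_l^I 𝔩_I`, for which `Sω
= ωω`, `SA_l = d_l ω + ωA_l - A_l ω`, `Sψ = ωψ` and `Sψ̄ = ψ̄ω`. The Jacobi identity and the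
representation property become associativity of matrix products, and orthonormality of the frame
recovers components from matrices (`GaugeFrame.eq_zero_of_toMatrix`). In the same calculus `∇ψ`,
`∇ψ̄` and `F` transform covariantly, so the contractions `ψ̄ · ∇̸ψ` and the trace of `FF` are
invariant, whence `S 𝓛₀ = 0`.

The ghost Lagrangian and `S 𝓚` differ only in the factor on which the derivative falls; the product
rule turns the difference into `d_H 𝓜` (`ellGhost_eq_brst_add`).

For the currents, let `M^l` have order one. The second-order Noether expression of the divergence
`d_n M^n` collapses to `δ[v] M^l` as soon as `∂_i^m M^l` is symmetric in `l` and `m`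
(`noetherP_two_divergence`). For `𝓜` this symmetry is that of `g^{lm}`, and `δ[v] M^l` is exactly
the change of `N^l`, so the two cancel. Raising `k` beyond the true order adds only vanishing terms
(`noetherP_of_le`). Finally `δ[v] 𝓜` still has order one, since `ω_{;m} = SA_m` is killed by `S`;
this keeps the new `N` within the order allowed by the definition of invariance. -/

theorem tmap_id_mul {A B : Type*} [Ring A] [Algebra ℂ A] [Ring B] [Algebra ℂ B]
    {D : B →ₗ[ℂ] B} (h : ∀ x y, D (x * y) = D x * D y) (x y : A ⊗[ℂ] B) :
    TensorProduct.map LinearMap.id D (x * y) =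
      TensorProduct.map LinearMap.id D x * TensorProduct.map LinearMap.id D y := by
  induction x using TensorProduct.induction_on with
  | zero => simp
  | add x y hx hy => simp only [add_mul, map_add, hx, hy]
  | tmul a b =>
    induction y using TensorProduct.induction_on with
    | zero => simp
    | add x y hx hy => simp only [mul_add, map_add, hx, hy]
    | tmul c d => simp [h]

theorem tmap_id_leibniz {A B : Type*} [Ring A] [Algebra ℂ A] [Ring B] [Algebra ℂ B]
    {D T : B →ₗ[ℂ] B} (h : ∀ x y, D (x * y) = D x * y + T x * D y) (x y : A ⊗[ℂ] B) :
    TensorProduct.map LinearMap.id D (x * y) =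
      TensorProduct.map LinearMap.id D x * y +
        TensorProduct.map LinearMap.id T x * TensorProduct.map LinearMap.id D y := by
  induction x using TensorProduct.induction_on with
  | zero => simp
  | add x y hx hy => simp only [add_mul, map_add, hx, hy]; abel
  | tmul a b =>
    induction y using TensorProduct.induction_on with
    | zero => simp
    | add x y hx hy => simp only [mul_add, map_add, hx, hy]; abel
    | tmul c d => simp [h, TensorProduct.tmul_add]

theorem tmap_leibniz_id {A B : Type*} [Ring A] [Algebra ℂ A] [Ring B] [Algebra ℂ B]
    {D : A →ₗ[ℂ] A} (h : ∀ x y, D (x * y) = D x * y + x * D y) (x y : A ⊗[ℂ] B) :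
    TensorProduct.map D LinearMap.id (x * y) =
      TensorProduct.map D LinearMap.id x * y + x * TensorProduct.map D LinearMap.id y := by
  induction x using TensorProduct.induction_on with
  | zero => simp
  | add x y hx hy => simp only [add_mul, map_add, hx, hy]; abel
  | tmul a b =>
    induction y using TensorProduct.induction_on with
    | zero => simp
    | add x y hx hy => simp only [mul_add, map_add, hx, hy]; abel
    | tmul c d => simp [h, TensorProduct.add_tmul]

/-- Contraction is known on a product whose left factor is a vector; induction on the left factor
extends this to the full graded rule. -/
theorem contractLeft_leibniz {O : Type} (d : Module.Dual ℂ (O →₀ ℂ))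
    (a b : ExteriorAlgebra ℂ (O →₀ ℂ)) :
    CliffordAlgebra.contractLeft (Q := 0) d (a * b) =
      CliffordAlgebra.contractLeft (Q := 0) d a * b +
        CliffordAlgebra.involute (Q := 0) a * CliffordAlgebra.contractLeft (Q := 0) d b := by
  induction a using CliffordAlgebra.left_induction with
  | algebraMap r =>
    rw [CliffordAlgebra.contractLeft_algebraMap_mul, CliffordAlgebra.contractLeft_algebraMap,
      AlgHom.commutes]
    simp
  | add x y hx hy => simp only [add_mul, map_add, hx, hy]; abel
  | ι_mul x m hx =>
    rw [mul_assoc, CliffordAlgebra.contractLeft_ι_mul, hx, CliffordAlgebra.contractLeft_ι_mul,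
      map_mul, CliffordAlgebra.involute_ι]
    simp only [sub_mul, mul_add, smul_mul_assoc, neg_mul, mul_assoc]
    abel

theorem involute_contractLeft {O : Type} (d : Module.Dual ℂ (O →₀ ℂ))
    (a : ExteriorAlgebra ℂ (O →₀ ℂ)) :
    CliffordAlgebra.involute (Q := 0) (CliffordAlgebra.contractLeft (Q := 0) d a) =
      -CliffordAlgebra.contractLeft (Q := 0) d (CliffordAlgebra.involute (Q := 0) a) := by
  induction a using CliffordAlgebra.left_induction with
  | algebraMap r => simp [CliffordAlgebra.contractLeft_algebraMap]
  | add x y hx hy => simp only [map_add, hx, hy]; abel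
  | ι_mul x m hx =>
    rw [CliffordAlgebra.contractLeft_ι_mul, map_sub, map_mul, map_mul, hx, map_smul,
      CliffordAlgebra.involute_ι, neg_mul, neg_mul, map_neg, CliffordAlgebra.contractLeft_ι_mul]
    simp

namespace FPoly

/-- The symmetric and exterior factors are generated by their variables. Complex scalars need no
case of their own: they are constant smooth functions, hence covered by `hcoef`. -/
theorem induction_gen {C : FPoly U ι κ Zb Zf → Prop} (hcoef : ∀ s, C (coef s))
    (heven : ∀ e, C (evenVar e)) (hodd : ∀ o, C (oddVar o))
    (hadd : ∀ f g, C f → C g → C (f + g)) (hmul : ∀ f g, C f → C g → C (f * g))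
    (f : FPoly U ι κ Zb Zf) : C f := by
  have hzero : C 0 := by simpa [coef] using hcoef 0
  have hconst : ∀ r : ℂ, C (1 ⊗ₜ[ℂ] (r • 1 : SPoly ι κ Zb Zf)) := fun r => by
    simpa [coef, TensorProduct.smul_tmul] using hcoef (r • 1)
  have he : ∀ a : MvPolynomial (EvenGen ι Zb) ℂ,
      C (1 ⊗ₜ[ℂ] (a ⊗ₜ[ℂ] 1 : SPoly ι κ Zb Zf)) := fun a => by
    induction a using MvPolynomial.induction_on with
    | C r =>
      have := hconst r
      rwa [Algebra.TensorProduct.one_def, TensorProduct.smul_tmul', ← MvPolynomial.C_1,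
        ← MvPolynomial.C_mul', ← MvPolynomial.C_mul, mul_one] at this
    | add p q hp hq => simpa [TensorProduct.add_tmul, TensorProduct.tmul_add] using hadd _ _ hp hq
    | mul_X p n hp => simpa [evenVar] using hmul _ _ hp (heven n)
  have ho : ∀ b : ExteriorAlgebra ℂ (OddGen ι κ Zf →₀ ℂ),
      C (1 ⊗ₜ[ℂ] ((1 : MvPolynomial (EvenGen ι Zb) ℂ) ⊗ₜ[ℂ] b)) := fun b => by
    induction b using CliffordAlgebra.induction with
    | algebraMap r =>
      have := hconst r
      rwa [Algebra.TensorProduct.one_def, ← TensorProduct.tmul_smul,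
        ← Algebra.algebraMap_eq_smul_one] at this
    | ι m =>
      induction m using Finsupp.induction_linear with
      | zero => simpa using hzero
      | add p q hp hq => simpa [TensorProduct.tmul_add] using hadd _ _ hp hq
      | single o r =>
        have := hmul _ _ (hconst r) (hodd o)
        have h1 : (Finsupp.single o r : OddGen ι κ Zf →₀ ℂ) = r • Finsupp.single o 1 := by simp
        rw [h1, map_smul, TensorProduct.tmul_smul]
        simpa [oddVar, ExteriorAlgebra.ι] using this
    | mul a b ha hb => simpa using hmul _ _ ha hb
    | add p q hp hq => simpa [TensorProduct.tmul_add] using hadd _ _ hp hq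
  induction f using TensorProduct.induction_on with
  | zero => exact hzero
  | add x y hx hy => exact hadd _ _ hx hy
  | tmul s q =>
    have hq : C (1 ⊗ₜ q) := by
      induction q using TensorProduct.induction_on with
      | zero => simpa using hzero
      | add x y hx hy => simpa [TensorProduct.tmul_add] using hadd _ _ hx hy
      | tmul a b => simpa using hmul _ _ (he a) (ho b)
    simpa [coef] using hmul _ _ (hcoef s) hq

end FPoly

/-! ### Parity and supercommutativity. -/

theorem coef_mul (s t : Smooth U) :
    (coef (s * t) : FPoly U ι κ Zb Zf) = coef s * coef t := by simp [coef]

theorem coef_one : (coef (1 : Smooth U) : FPoly U ι κ Zb Zf) = 1 := rfl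

theorem parity_mul (f g : FPoly U ι κ Zb Zf) : parity (f * g) = parity f * parity g :=
  tmap_id_mul (tmap_id_mul fun x y => by simp) f g

@[simp] theorem parity_coef (s : Smooth U) : parity (coef s : FPoly U ι κ Zb Zf) = coef s := by
  simp [parity, coef, Algebra.TensorProduct.one_def]

@[simp] theorem parity_evenVar (e : EvenGen ι Zb) :
    parity (evenVar e : FPoly U ι κ Zb Zf) = evenVar e := by
  simp [parity, evenVar]

@[simp] theorem parity_oddVar (o : OddGen ι κ Zf) :
    parity (oddVar o : FPoly U ι κ Zb Zf) = -oddVar o := by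
  simp [parity, oddVar, ExteriorAlgebra.ι, CliffordAlgebra.involute_ι, TensorProduct.tmul_neg]

@[simp] theorem parity_parity (f : FPoly U ι κ Zb Zf) : parity (parity f) = f := by
  induction f using FPoly.induction_gen with
  | hcoef s => simp
  | heven e => simp
  | hodd o => simp
  | hadd f g hf hg => simp [hf, hg]
  | hmul f g hf hg => simp [parity_mul, hf, hg]

/-- The parity involution, or the identity. -/
def twist (b : Bool) : FPoly U ι κ Zb Zf →ₗ[ℂ] FPoly U ι κ Zb Zf :=
  bif b then parity else LinearMap.id

@[simp] theorem twist_true (f : FPoly U ι κ Zb Zf) : twist true f = parity f := rfl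
@[simp] theorem twist_false (f : FPoly U ι κ Zb Zf) : twist false f = f := rfl

theorem twist_mul (b : Bool) (f g : FPoly U ι κ Zb Zf) :
    twist b (f * g) = twist b f * twist b g := by
  cases b <;> simp [parity_mul]

theorem twist_twist (b c : Bool) (f : FPoly U ι κ Zb Zf) :
    twist b (twist c f) = twist (b ^^ c) f := by
  cases b <;> cases c <;> simp

/-- `f` is homogeneous of even (`false`) or odd (`true`) degree. -/
def HasParity (b : Bool) (f : FPoly U ι κ Zb Zf) : Prop := parity f = bif b then -f else f

theorem hasParity_true {f : FPoly U ι κ Zb Zf} : HasParity true f ↔ parity f = -f := Iff.rfl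
theorem hasParity_false {f : FPoly U ι κ Zb Zf} : HasParity false f ↔ parity f = f := Iff.rfl

theorem hasParity_coef (s : Smooth U) : HasParity false (coef s : FPoly U ι κ Zb Zf) :=
  parity_coef s
theorem hasParity_jet (i : Fld ι κ) (Λ : MIdx) :
    HasParity i.isRight (jet i Λ : FPoly U ι κ Zb Zf) := by
  cases i
  exacts [parity_evenVar _, parity_oddVar _]

namespace HasParity

variable {b c : Bool} {f g : FPoly U ι κ Zb Zf}

theorem zero : HasParity b (0 : FPoly U ι κ Zb Zf) := by cases b <;> simp [HasParity]
theorem add (hf : HasParity b f) (hg : HasParity b g) : HasParity b (f + g) := by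
  cases b <;> simp_all [HasParity, add_comm]
theorem neg (hf : HasParity b f) : HasParity b (-f) := by
  cases b <;> simp_all [HasParity]
theorem sub (hf : HasParity b f) (hg : HasParity b g) : HasParity b (f - g) := by
  rw [sub_eq_add_neg]; exact hf.add hg.neg
theorem smul (r : ℂ) (hf : HasParity b f) : HasParity b (r • f) := by
  cases b <;> simp_all [HasParity]
theorem sum {J : Type*} {s : Finset J} {F : J → FPoly U ι κ Zb Zf}
    (h : ∀ j ∈ s, HasParity b (F j)) : HasParity b (∑ j ∈ s, F j) :=
  Finset.sum_induction _ _ (fun _ _ => add) zero h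
theorem mul (hf : HasParity b f) (hg : HasParity c g) : HasParity (b ^^ c) (f * g) := by
  cases b <;> cases c <;> simp_all [HasParity, parity_mul]

end HasParity

theorem coef_comm (s : Smooth U) (f : FPoly U ι κ Zb Zf) : coef s * f = f * coef s := by
  induction f using TensorProduct.induction_on with
  | zero => simp
  | add x y hx hy => simp only [mul_add, add_mul, hx, hy]
  | tmul a q => simp [coef, mul_comm]

theorem evenVar_comm (e : EvenGen ι Zb) (f : FPoly U ι κ Zb Zf) :
    evenVar e * f = f * evenVar e := by
  induction f using FPoly.induction_gen with
  | hcoef s => exact (coef_comm s _).symm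
  | heven e' => simp [evenVar, mul_comm]
  | hodd o => simp [evenVar, oddVar]
  | hadd f g hf hg => simp only [mul_add, add_mul, hf, hg]
  | hmul f g hf hg => rw [← mul_assoc, hf, mul_assoc, hg, mul_assoc]

theorem oddVar_anticomm (o o' : OddGen ι κ Zf) :
    (oddVar o * oddVar o' : FPoly U ι κ Zb Zf) = -(oddVar o' * oddVar o) := by
  have h := eq_neg_of_add_eq_zero_left
    (ExteriorAlgebra.ι_add_mul_swap (R := ℂ) (Finsupp.single o (1 : ℂ)) (Finsupp.single o' 1))
  simp [oddVar, h, TensorProduct.tmul_neg]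

theorem oddVar_comm (o : OddGen ι κ Zf) (f : FPoly U ι κ Zb Zf) :
    oddVar o * f = parity f * oddVar o := by
  induction f using FPoly.induction_gen with
  | hcoef s => rw [parity_coef, coef_comm]
  | heven e' => rw [parity_evenVar, evenVar_comm]
  | hodd o' => rw [oddVar_anticomm, parity_oddVar, neg_mul]
  | hadd f g hf hg => simp only [mul_add, add_mul, map_add, hf, hg]
  | hmul f g hf hg => rw [← mul_assoc, hf, mul_assoc, hg, parity_mul, mul_assoc]

/-- The factor `g` need not be homogeneous: with the sign encoded by the involution `twist b`, both
sides are compatible with sums and products in `g`, so generators suffice. -/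
theorem HasParity.supercomm {b : Bool} {f : FPoly U ι κ Zb Zf} (hf : HasParity b f)
    (g : FPoly U ι κ Zb Zf) : f * g = twist b g * f := by
  induction g using FPoly.induction_gen with
  | hcoef s => cases b <;> simp [coef_comm]
  | heven e' => cases b <;> simp [evenVar_comm]
  | hodd o' =>
    have h := oddVar_comm o' f
    cases b
    · rw [hasParity_false.1 hf] at h; exact h.symm
    · rw [hasParity_true.1 hf, neg_mul] at h
      rw [twist_true, parity_oddVar, neg_mul, h, neg_neg]
  | hadd f g hf hg => simp only [mul_add, add_mul, map_add, hf, hg]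
  | hmul f g hf hg => rw [← mul_assoc, hf, mul_assoc, hg, twist_mul, mul_assoc]

theorem HasParity.even_comm {f : FPoly U ι κ Zb Zf} (hf : HasParity false f)
    (g : FPoly U ι κ Zb Zf) : f * g = g * f := hf.supercomm g

/-- `D` is a derivation (`b = false`) or an anti-derivation (`b = true`) of that parity. -/
structure IsSuperDer (b : Bool) (D : FPoly U ι κ Zb Zf →ₗ[ℂ] FPoly U ι κ Zb Zf) : Prop where
  leibniz : ∀ f g, D (f * g) = D f * g + twist b f * D g
  parity : ∀ f, parity (D f) = bif b then -D (parity f) else D (parity f)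

theorem IsSuperDer.hasParity {b c : Bool} {D : FPoly U ι κ Zb Zf →ₗ[ℂ] FPoly U ι κ Zb Zf}
    (hD : IsSuperDer b D) {f : FPoly U ι κ Zb Zf} (hf : HasParity c f) :
    HasParity (b ^^ c) (D f) := by
  have := hD.parity f
  cases b <;> cases c <;> simp_all [HasParity]

theorem IsSuperDer.zero (b : Bool) :
    IsSuperDer b (0 : FPoly U ι κ Zb Zf →ₗ[ℂ] FPoly U ι κ Zb Zf) :=
  ⟨by simp, by cases b <;> simp⟩

theorem isSuperDer_pd (p : Fld ι κ × MIdx) :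
    IsSuperDer p.1.isRight (pd p : FPoly U ι κ Zb Zf →ₗ[ℂ] FPoly U ι κ Zb Zf) := by
  obtain ⟨i | i, Λ⟩ := p
  · constructor
    · intro f g
      have h1 : ∀ x y : SPoly ι κ Zb Zf, _ := tmap_leibniz_id
        (D := (MvPolynomial.pderiv (.inr (i, Λ) : EvenGen ι Zb)).toLinearMap) (fun x y => by
          change MvPolynomial.pderiv _ (x * y) = _
          rw [Derivation.leibniz]
          simp [mul_comm, add_comm])
      have := tmap_id_leibniz (A := Smooth U) (T := LinearMap.id) h1 f g
      rw [TensorProduct.map_id] at this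
      exact this
    · intro f
      simp only [pd, parity, Sum.isRight_inl, cond_false]
      rw [← LinearMap.comp_apply, ← LinearMap.comp_apply, ← TensorProduct.map_comp,
        ← TensorProduct.map_comp, ← TensorProduct.map_comp, ← TensorProduct.map_comp]
      rfl
  · constructor
    · intro f g
      exact tmap_id_leibniz (tmap_id_leibniz (T := (CliffordAlgebra.involute (Q := 0)).toLinearMap)
        fun x y => contractLeft_leibniz _ x y) f g
    · intro f
      simp only [pd, parity, Sum.isRight_inr, cond_true]
      induction f using TensorProduct.induction_on with
      | zero => simp
      | add x y hx hy => simp only [map_add, hx, hy, neg_add]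
      | tmul s q =>
        induction q using TensorProduct.induction_on with
        | zero => simp
        | add x y hx hy => simp only [TensorProduct.tmul_add, map_add, hx, hy, neg_add]
        | tmul a b =>
          have := involute_contractLeft (Finsupp.lapply (.inr (i, Λ) : OddGen ι κ Zf)) b
          simp [this, TensorProduct.tmul_neg]

@[simp] theorem pd_coef (p : Fld ι κ × MIdx) (s : Smooth U) :
    pd p (coef s : FPoly U ι κ Zb Zf) = 0 := by
  obtain ⟨i | i, Λ⟩ := p <;> simp [pd, coef, Algebra.TensorProduct.one_def,
    CliffordAlgebra.contractLeft_one]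

@[simp] theorem pd_evenVar_inl (p : Fld ι κ × MIdx) (z : Zb) :
    pd p (evenVar (.inl z) : FPoly U ι κ Zb Zf) = 0 := by
  classical
  obtain ⟨i | i, Λ⟩ := p <;> simp [pd, evenVar, CliffordAlgebra.contractLeft_one,
    MvPolynomial.pderiv_X]

theorem contractLeft_ι_single {O : Type} [DecidableEq O] (o o' : O) :
    CliffordAlgebra.contractLeft (Q := 0) (Finsupp.lapply o)
      (ExteriorAlgebra.ι ℂ (Finsupp.single o' (1 : ℂ))) = if o' = o then 1 else 0 := by
  rw [ExteriorAlgebra.ι, CliffordAlgebra.contractLeft_ι, Finsupp.lapply_apply,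
    Finsupp.single_apply]
  split_ifs <;> simp

@[simp] theorem pd_oddVar_inl (p : Fld ι κ × MIdx) (z : Zf) :
    pd p (oddVar (.inl z) : FPoly U ι κ Zb Zf) = 0 := by
  classical
  obtain ⟨i | i, Λ⟩ := p
  · simp [pd, oddVar]
  · rw [pd, oddVar, TensorProduct.map_tmul, TensorProduct.map_tmul, contractLeft_ι_single]
    simp

theorem pd_jet [DecidableEq (Fld ι κ × MIdx)] (p : Fld ι κ × MIdx) (i : Fld ι κ) (Λ : MIdx) :
    pd p (jet i Λ : FPoly U ι κ Zb Zf) = if (i, Λ) = p then 1 else 0 := by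
  classical
  obtain ⟨j | j, M⟩ := p <;> cases i
  · simp [pd, jet, evenVar, MvPolynomial.pderiv_X, Pi.single_apply, TensorProduct.tmul_ite,
      TensorProduct.ite_tmul, Algebra.TensorProduct.one_def]
  · simp [pd, jet, oddVar]
  · simp [pd, jet, evenVar, CliffordAlgebra.contractLeft_one]
  · rw [pd, jet, oddVar, TensorProduct.map_tmul, TensorProduct.map_tmul, contractLeft_ι_single]
    simp [TensorProduct.tmul_ite, Algebra.TensorProduct.one_def]

/-! ## Partial derivatives of smooth functions -/

/-- `fderiv` only sees the germ at a point, and `U` is open. The extension by zero may thus be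
exchanged for any formula valid on `U` before differentiating. -/
theorem Smooth.ext_eventuallyEq (f : Smooth U) (F : Pt → ℂ) (h : ∀ y : U, f.1 y = F y) (x : U) :
    ext f.1 =ᶠ[nhds (x : Pt)] F := by
  filter_upwards [U.isOpen.mem_nhds x.2] with y hy
  exact (ext_apply f.1 ⟨y, hy⟩).trans (h ⟨y, hy⟩)

theorem Smooth.partialD_mul (l : Fin 4) (f g : Smooth U) :
    Smooth.partialD l (f * g) = Smooth.partialD l f * g + f * Smooth.partialD l g := by
  ext x
  have h := Smooth.ext_eventuallyEq (f * g) (ext f.1 * ext g.1) (fun y => by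
    rw [Pi.mul_apply, ext_apply, ext_apply]; rfl) x
  change fderiv ℝ (ext (f * g : Smooth U).1) x _ = fderiv ℝ (ext f.1) x _ * g.1 x +
    f.1 x * fderiv ℝ (ext g.1) x _
  rw [h.fderiv_eq, fderiv_mul (Smooth.differentiableAt f x) (Smooth.differentiableAt g x),
    ext_apply, ext_apply, add_comm]
  simp [mul_comm]

theorem Smooth.partialD_comm (l m : Fin 4) (f : Smooth U) :
    Smooth.partialD l (Smooth.partialD m f) = Smooth.partialD m (Smooth.partialD l f) := by
  ext x
  have hf : ContDiffAt ℝ ∞ (ext f.1) x := f.2.contDiffAt (U.isOpen.mem_nhds x.2)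
  have hd : DifferentiableAt ℝ (fderiv ℝ (ext f.1)) x :=
    (hf.fderiv_right (m := 1) (by rw [one_add_one_eq_two]; exact WithTop.coe_le_coe.2 le_top)).differentiableAt (by simp)
  have key : ∀ l m : Fin 4, (Smooth.partialD l (Smooth.partialD m f)).1 x =
      fderiv ℝ (fderiv ℝ (ext f.1)) x (Pi.single l 1) (Pi.single m 1) := fun l m => by
    have h := Smooth.ext_eventuallyEq (Smooth.partialD m f)
      (fun y => fderiv ℝ (ext f.1) y (Pi.single m 1)) (fun y => rfl) x
    change fderiv ℝ (ext (Smooth.partialD m f).1) x _ = _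
    rw [h.fderiv_eq, fderiv_clm_apply hd (differentiableAt_const _)]
    simp
  change (Smooth.partialD l (Smooth.partialD m f)).1 x =
    (Smooth.partialD m (Smooth.partialD l f)).1 x
  rw [key, key]
  exact hf.isSymmSndFDerivAt (by
    rw [minSmoothness_of_isRCLikeNormedField]; exact WithTop.coe_le_coe.2 le_top) _ _

/-! ## Super-derivations -/

/-- The horizontal part `∂_l` of the total derivative. -/
def partialH (l : Fin 4) : FPoly U ι κ Zb Zf →ₗ[ℂ] FPoly U ι κ Zb Zf :=
  TensorProduct.map (Smooth.partialD l) LinearMap.id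

@[simp] theorem partialD_one (l : Fin 4) : Smooth.partialD l (1 : Smooth U) = 0 := by
  simpa using Smooth.partialD_mul l (1 : Smooth U) 1

theorem isSuperDer_partialH (l : Fin 4) :
    IsSuperDer false (partialH l : FPoly U ι κ Zb Zf →ₗ[ℂ] FPoly U ι κ Zb Zf) where
  leibniz f g := by
    rw [twist_false]
    exact tmap_leibniz_id (A := Smooth U) (B := SPoly ι κ Zb Zf) (D := Smooth.partialD l)
      (Smooth.partialD_mul l) f g
  parity f := by
    rw [cond_false]
    induction f using TensorProduct.induction_on with
    | zero => simp
    | add x y hx hy => simp only [map_add, hx, hy]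
    | tmul s q => rfl

theorem vert_apply (w : Fld ι κ × MIdx → FPoly U ι κ Zb Zf) (f : FPoly U ι κ Zb Zf) :
    vert w f = ∑ᶠ p, w p * pd p f := rfl

theorem finite_support_mul_pd (w : Fld ι κ × MIdx → FPoly U ι κ Zb Zf) (f : FPoly U ι κ Zb Zf) :
    (Function.support fun p => w p * pd p f).Finite :=
  (pd_finite f).subset fun p hp h => hp (by simp [h])

/-- In the second Leibniz term `pd p` twists `f` by the parity of `p`, and moving `w p` to the right
past `f` twists it by `b` plus that parity. The parity of `p` cancels, leaving the same sign `b` in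
every summand. -/
theorem isSuperDer_vert {b : Bool} {w : Fld ι κ × MIdx → FPoly U ι κ Zb Zf}
    (hw : ∀ p, HasParity (b ^^ p.1.isRight) (w p)) : IsSuperDer b (vert w) where
  leibniz f g := by
    have h1 := finite_support_mul_pd w f
    have h2 := finite_support_mul_pd w g
    simp only [vert_apply]
    rw [finsum_mul' _ _ h1, mul_finsum' _ _ h2, ← finsum_add_distrib]
    · refine finsum_congr fun p => ?_
      rw [(isSuperDer_pd p).leibniz, mul_add, ← mul_assoc, ← mul_assoc, ← mul_assoc,
        (hw p).supercomm (twist _ f), twist_twist, Bool.xor_assoc, Bool.xor_self, Bool.xor_false]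
    · exact h1.subset fun p hp h => hp (by simp only [h, zero_mul])
    · exact h2.subset fun p hp h => hp (by simp only [h, mul_zero])
  parity f := by
    have h1 := finite_support_mul_pd w f
    simp only [vert_apply]
    have h2 := AddMonoidHom.map_finsum
      (parity : FPoly U ι κ Zb Zf →ₗ[ℂ] FPoly U ι κ Zb Zf).toAddMonoidHom h1
    refine h2.trans ?_
    have h3 : ∀ p, parity (w p * pd p f) =
        bif b then -(w p * pd p (parity f)) else w p * pd p (parity f) := fun p => by
      rw [parity_mul, (isSuperDer_pd p).parity]
      have := hw p
      cases b <;> cases hp : p.1.isRight <;> simp_all [HasParity]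
    cases b
    · exact finsum_congr h3
    · exact (finsum_congr h3).trans (finsum_neg_distrib _)

@[simp] theorem vert_coef (w : Fld ι κ × MIdx → FPoly U ι κ Zb Zf) (s : Smooth U) :
    vert w (coef s) = 0 := by simp [vert_apply]

@[simp] theorem vert_evenVar_inl (w : Fld ι κ × MIdx → FPoly U ι κ Zb Zf) (z : Zb) :
    vert w (evenVar (.inl z)) = 0 := by simp [vert_apply]

@[simp] theorem vert_oddVar_inl (w : Fld ι κ × MIdx → FPoly U ι κ Zb Zf) (z : Zf) :
    vert w (oddVar (.inl z)) = 0 := by simp [vert_apply]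

@[simp] theorem vert_jet (w : Fld ι κ × MIdx → FPoly U ι κ Zb Zf) (i : Fld ι κ) (Λ : MIdx) :
    vert w (jet i Λ) = w (i, Λ) := by
  classical
  rw [vert_apply, finsum_eq_single _ (i, Λ) fun p hp => by rw [pd_jet, if_neg hp.symm, mul_zero],
    pd_jet, if_pos rfl, mul_one]

namespace FPoly

/-- Induction over the functions, the constants and the jet coordinates. -/
theorem induction_jet {C : FPoly U ι κ Zb Zf → Prop} (hcoef : ∀ s, C (coef s))
    (heven : ∀ z, C (evenVar (.inl z))) (hodd : ∀ z, C (oddVar (.inl z)))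
    (hjet : ∀ i Λ, C (jet i Λ))
    (hadd : ∀ f g, C f → C g → C (f + g)) (hmul : ∀ f g, C f → C g → C (f * g))
    (f : FPoly U ι κ Zb Zf) : C f := by
  refine induction_gen hcoef ?_ ?_ hadd hmul f
  · rintro (z | ⟨i, Λ⟩)
    exacts [heven z, hjet (.inl i) Λ]
  · rintro (z | ⟨i, Λ⟩)
    exacts [hodd z, hjet (.inr i) Λ]

end FPoly

/-- A commutation relation between an even derivation and a super-derivation holds if it holds on
functions, constants and jet coordinates. -/
theorem IsSuperDer.commutator_eq {b : Bool} {D E F : FPoly U ι κ Zb Zf →ₗ[ℂ] FPoly U ι κ Zb Zf}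
    (hD : IsSuperDer false D) (hE : IsSuperDer b E) (hF : IsSuperDer b F)
    (hcoef : ∀ s, D (E (coef s)) = E (D (coef s)) + F (coef s))
    (heven : ∀ z, D (E (evenVar (.inl z))) = E (D (evenVar (.inl z))) + F (evenVar (.inl z)))
    (hodd : ∀ z, D (E (oddVar (.inl z))) = E (D (oddVar (.inl z))) + F (oddVar (.inl z)))
    (hjet : ∀ i Λ, D (E (jet i Λ)) = E (D (jet i Λ)) + F (jet i Λ)) (f : FPoly U ι κ Zb Zf) :
    D (E f) = E (D f) + F f := by
  induction f using FPoly.induction_jet with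
  | hcoef s => exact hcoef s
  | heven z => exact heven z
  | hodd z => exact hodd z
  | hjet i Λ => exact hjet i Λ
  | hadd f g hf hg => simp only [map_add, hf, hg]; abel
  | hmul f g hf hg =>
    -- An even derivation preserves parity, so the mixed terms of `D E` and `E D` on a product agree
    -- and cancel.
    have ht : D (twist b f) = twist b (D f) := by
      cases b
      · rfl
      · exact (hD.parity f).symm
    simp only [hE.leibniz, hD.leibniz, hF.leibniz, map_add, hf, hg, twist_false, ht, add_mul,
      mul_add]
    abel

/-- The square of an anti-derivation vanishes if it does so on functions, constants and jet
coordinates. -/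
theorem IsSuperDer.sq_eq_zero {E : FPoly U ι κ Zb Zf →ₗ[ℂ] FPoly U ι κ Zb Zf}
    (hE : IsSuperDer true E) (hcoef : ∀ s, E (E (coef s)) = 0)
    (heven : ∀ z, E (E (evenVar (.inl z))) = 0) (hodd : ∀ z, E (E (oddVar (.inl z))) = 0)
    (hjet : ∀ i Λ, E (E (jet i Λ)) = 0) (f : FPoly U ι κ Zb Zf) : E (E f) = 0 := by
  induction f using FPoly.induction_jet with
  | hcoef s => exact hcoef s
  | heven z => exact heven z
  | hodd z => exact hodd z
  | hjet i Λ => exact hjet i Λ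
  | hadd f g hf hg => simp only [map_add, hf, hg, add_zero]
  | hmul f g hf hg =>
    -- The mixed terms of `E (E (f g))` are `parity (E f) * E g` and `E (parity f) * E g`; they are
    -- opposite because `E` is odd.
    have hp := hE.parity f
    rw [cond_true] at hp
    simp only [hE.leibniz, map_add, hf, hg, twist_true, hp, parity_parity, neg_mul, mul_zero,
      zero_mul, add_zero, zero_add, neg_add_cancel]

/-! ## Total derivatives and prolongations -/

theorem totalD_apply (l : Fin 4) (f : FPoly U ι κ Zb Zf) :
    totalD l f = partialH l f + vert (fun p => jet p.1 (p.2 + Pi.single l 1)) f := rfl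

theorem IsSuperDer.add {b : Bool} {D E : FPoly U ι κ Zb Zf →ₗ[ℂ] FPoly U ι κ Zb Zf}
    (hD : IsSuperDer b D) (hE : IsSuperDer b E) : IsSuperDer b (D + E) where
  leibniz f g := by
    simp only [LinearMap.add_apply, hD.leibniz, hE.leibniz, add_mul, mul_add]; abel
  parity f := by
    simp only [LinearMap.add_apply, map_add, hD.parity, hE.parity]
    cases b
    · rfl
    · exact (neg_add _ _).symm

theorem isSuperDer_totalD (l : Fin 4) :
    IsSuperDer false (totalD l : FPoly U ι κ Zb Zf →ₗ[ℂ] FPoly U ι κ Zb Zf) :=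
  (isSuperDer_partialH l).add (isSuperDer_vert fun p => by
    rw [Bool.false_xor]; exact hasParity_jet _ _)

theorem totalD_mul (l : Fin 4) (f g : FPoly U ι κ Zb Zf) :
    totalD l (f * g) = totalD l f * g + f * totalD l g := (isSuperDer_totalD l).leibniz f g

@[simp] theorem totalD_coef (l : Fin 4) (s : Smooth U) :
    totalD l (coef s : FPoly U ι κ Zb Zf) = coef (Smooth.partialD l s) := by
  rw [totalD_apply, vert_coef, add_zero]; rfl

theorem partialH_tmul_one (l : Fin 4) (q : SPoly ι κ Zb Zf) :
    partialH l ((1 : Smooth U) ⊗ₜ[ℂ] q) = 0 := by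
  rw [partialH, TensorProduct.map_tmul, partialD_one, TensorProduct.zero_tmul]

@[simp] theorem totalD_evenVar_inl (l : Fin 4) (z : Zb) :
    totalD l (evenVar (.inl z) : FPoly U ι κ Zb Zf) = 0 := by
  rw [totalD_apply, vert_evenVar_inl, add_zero]; exact partialH_tmul_one l _

@[simp] theorem totalD_oddVar_inl (l : Fin 4) (z : Zf) :
    totalD l (oddVar (.inl z) : FPoly U ι κ Zb Zf) = 0 := by
  rw [totalD_apply, vert_oddVar_inl, add_zero]; exact partialH_tmul_one l _

@[simp] theorem totalD_jet (l : Fin 4) (i : Fld ι κ) (Λ : MIdx) :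
    totalD l (jet i Λ : FPoly U ι κ Zb Zf) = jet i (Λ + Pi.single l 1) := by
  rw [totalD_apply, vert_jet, add_eq_right]
  cases i <;> exact partialH_tmul_one l _

theorem totalD_comm (l m : Fin 4) (f : FPoly U ι κ Zb Zf) :
    totalD l (totalD m f) = totalD m (totalD l f) := by
  refine ((isSuperDer_totalD l).commutator_eq (isSuperDer_totalD m) (IsSuperDer.zero false)
    (fun s => ?_) (fun z => ?_) (fun z => ?_) (fun i Λ => ?_) f).trans (add_zero _)
  · simp [Smooth.partialD_comm l m]
  · simp
  · simp
  · simp [add_right_comm]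

theorem totalD_commute (l m : Fin 4) :
    Commute (totalD l : FPoly U ι κ Zb Zf →ₗ[ℂ] FPoly U ι κ Zb Zf) (totalD m) :=
  LinearMap.ext fun f => totalD_comm l m f

@[simp] theorem dMulti_zero (f : FPoly U ι κ Zb Zf) : dMulti 0 f = f := by
  simp [dMulti]

/-- `dMulti` is a product in a fixed order, so an additional derivative must be moved through the
preceding powers; this is the only use of commutativity of the `d_l`. -/
theorem prod_pow_add_single {M : Type*} [Monoid M] {a : Fin 4 → M}
    (ha : ∀ m n, Commute (a m) (a n)) (l : Fin 4) (Λ : MIdx) :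
    a 0 ^ (Λ + Pi.single l 1 : MIdx) 0 * a 1 ^ (Λ + Pi.single l 1 : MIdx) 1 *
        a 2 ^ (Λ + Pi.single l 1 : MIdx) 2 * a 3 ^ (Λ + Pi.single l 1 : MIdx) 3 =
      a l * (a 0 ^ Λ 0 * a 1 ^ Λ 1 * a 2 ^ Λ 2 * a 3 ^ Λ 3) := by
  have h := fun (m n : Fin 4) (k : ℕ) => ((ha m n).pow_right k).eq
  obtain rfl | rfl | rfl | rfl : l = 0 ∨ l = 1 ∨ l = 2 ∨ l = 3 := by fin_cases l <;> simp
  · simp [pow_succ', mul_assoc]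
  · simp only [← mul_assoc, h 1 0]
    simp [pow_succ', mul_assoc]
  · simp only [← mul_assoc, h 2 0]
    simp only [mul_assoc (a 0 ^ Λ 0), h 2 1]
    simp [pow_succ', mul_assoc]
  · simp only [← mul_assoc, h 3 0]
    simp only [mul_assoc (a 0 ^ Λ 0), h 3 1]
    simp only [← mul_assoc]
    simp only [mul_assoc (a 0 ^ Λ 0 * a 1 ^ Λ 1), h 3 2]
    simp [pow_succ', mul_assoc]

theorem dMulti_add_single (l : Fin 4) (Λ : MIdx) :
    (dMulti (Λ + Pi.single l 1) : FPoly U ι κ Zb Zf →ₗ[ℂ] FPoly U ι κ Zb Zf) =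
      totalD l * dMulti Λ :=
  prod_pow_add_single totalD_commute l Λ

theorem dMulti_add_single_apply (l : Fin 4) (Λ : MIdx) (f : FPoly U ι κ Zb Zf) :
    dMulti (Λ + Pi.single l 1) f = totalD l (dMulti Λ f) := by
  rw [dMulti_add_single]; rfl

theorem dMulti_single (l : Fin 4) (f : FPoly U ι κ Zb Zf) :
    dMulti (Pi.single l 1) f = totalD l f := by
  rw [← zero_add (Pi.single l 1 : MIdx), dMulti_add_single_apply, dMulti_zero]

theorem MIdx.induction {C : MIdx → Prop} (h0 : C 0)
    (hs : ∀ Λ l, C Λ → C (Λ + Pi.single l 1)) (Λ : MIdx) : C Λ := by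
  obtain ⟨n, hn⟩ : ∃ n, ∑ l, Λ l = n := ⟨_, rfl⟩
  induction n generalizing Λ with
  | zero =>
    have : Λ = 0 := funext fun l => Finset.sum_eq_zero_iff.1 hn l (Finset.mem_univ l)
    rwa [this]
  | succ n ih =>
    obtain ⟨l, -, hl⟩ : ∃ l ∈ Finset.univ, Λ l ≠ 0 := by
      by_contra! h
      rw [Finset.sum_eq_zero h] at hn
      omega
    -- The subtraction of natural numbers is truncated; it is exact here because `Λ l ≠ 0`.
    have h1 : Λ - Pi.single l 1 + Pi.single l 1 = Λ := by
      ext m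
      by_cases hm : m = l
      · subst hm; simp; omega
      · simp [hm]
    rw [← h1]
    refine hs _ _ (ih _ ?_)
    have h2 : ∑ m, (Λ - Pi.single l 1 + Pi.single l 1 : MIdx) m = n + 1 := by rw [h1, hn]
    simpa [Finset.sum_add_distrib] using h2

theorem HasParity.totalD {b : Bool} {f : FPoly U ι κ Zb Zf} (hf : HasParity b f) (l : Fin 4) :
    HasParity b (totalD l f) := by
  simpa using (isSuperDer_totalD l).hasParity hf

theorem HasParity.dMulti {b : Bool} {f : FPoly U ι κ Zb Zf} (hf : HasParity b f) (Λ : MIdx) :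
    HasParity b (dMulti Λ f) := by
  induction Λ using MIdx.induction with
  | h0 => rwa [dMulti_zero]
  | hs Λ l h => rw [dMulti_add_single_apply]; exact h.totalD l

theorem isSuperDer_prolong {b : Bool} {v : Fld ι κ → FPoly U ι κ Zb Zf}
    (hv : ∀ i, HasParity (b ^^ i.isRight) (v i)) : IsSuperDer b (prolong v) :=
  isSuperDer_vert fun p => (hv p.1).dMulti p.2

@[simp] theorem prolong_coef (v : Fld ι κ → FPoly U ι κ Zb Zf) (s : Smooth U) :
    prolong v (coef s) = 0 := vert_coef _ _

@[simp] theorem prolong_evenVar_inl (v : Fld ι κ → FPoly U ι κ Zb Zf) (z : Zb) :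
    prolong v (evenVar (.inl z)) = 0 := vert_evenVar_inl _ _

@[simp] theorem prolong_oddVar_inl (v : Fld ι κ → FPoly U ι κ Zb Zf) (z : Zf) :
    prolong v (oddVar (.inl z)) = 0 := vert_oddVar_inl _ _

theorem prolong_jet (v : Fld ι κ → FPoly U ι κ Zb Zf) (i : Fld ι κ) (Λ : MIdx) :
    prolong v (jet i Λ) = dMulti Λ (v i) := vert_jet _ _ _

/-- Homogeneity of `v` makes its prolongation a super-derivation, so only generators matter; on a
jet coordinate both sides are the derivative of `v i` with multi-index `Λ + Pi.single l 1`. -/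
theorem prolong_totalD {b : Bool} {v : Fld ι κ → FPoly U ι κ Zb Zf}
    (hv : ∀ i, HasParity (b ^^ i.isRight) (v i)) (l : Fin 4) (f : FPoly U ι κ Zb Zf) :
    prolong v (totalD l f) = totalD l (prolong v f) := by
  refine (((isSuperDer_totalD l).commutator_eq (isSuperDer_prolong hv) (IsSuperDer.zero b)
    (fun s => ?_) (fun z => ?_) (fun z => ?_) (fun i Λ => ?_) f).trans (add_zero _)).symm
  · simp
  · simp
  · simp
  · rw [LinearMap.zero_apply, add_zero, totalD_jet, prolong_jet, prolong_jet,
      dMulti_add_single_apply]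

theorem prolong_dMulti {b : Bool} {v : Fld ι κ → FPoly U ι κ Zb Zf}
    (hv : ∀ i, HasParity (b ^^ i.isRight) (v i)) (Λ : MIdx) (f : FPoly U ι κ Zb Zf) :
    prolong v (dMulti Λ f) = dMulti Λ (prolong v f) := by
  induction Λ using MIdx.induction with
  | h0 => simp
  | hs Λ l h => rw [dMulti_add_single_apply, dMulti_add_single_apply, prolong_totalD hv, h]

/-- Total derivatives of constants vanish. -/
theorem totalD_constants {θ : FPoly U ι κ Zb Zf} (hθ : θ ∈ constants U ι κ Zb Zf) (l : Fin 4) :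
    totalD l θ = 0 := by
  induction hθ using Algebra.adjoin_induction with
  | mem x hx => rcases hx with ⟨z, rfl⟩ | ⟨z, rfl⟩ <;> simp
  | algebraMap r =>
    have h1 : totalD l (1 : FPoly U ι κ Zb Zf) = 0 := by
      rw [← coef_one, totalD_coef, partialD_one, coef, TensorProduct.zero_tmul]
    rw [Algebra.algebraMap_eq_smul_one, map_smul, h1, smul_zero]
  | add x y _ _ hx hy => rw [map_add, hx, hy, add_zero]
  | mul x y _ _ hx hy => rw [totalD_mul, hx, hy, zero_mul, mul_zero, add_zero]

/-- Partial derivatives of constants vanish. -/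
theorem pd_constants {θ : FPoly U ι κ Zb Zf} (hθ : θ ∈ constants U ι κ Zb Zf)
    (p : Fld ι κ × MIdx) : pd p θ = 0 := by
  induction hθ using Algebra.adjoin_induction with
  | mem x hx => rcases hx with ⟨z, rfl⟩ | ⟨z, rfl⟩ <;> simp
  | algebraMap r =>
    rw [Algebra.algebraMap_eq_smul_one, map_smul, ← coef_one, pd_coef, smul_zero]
  | add x y _ _ hx hy => rw [map_add, hx, hy, add_zero]
  | mul x y _ _ hx hy => rw [(isSuperDer_pd p).leibniz, hx, hy, zero_mul, mul_zero, add_zero]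

theorem dMulti_constants_mul {θ : FPoly U ι κ Zb Zf} (hθ : θ ∈ constants U ι κ Zb Zf) (Λ : MIdx)
    (f : FPoly U ι κ Zb Zf) : dMulti Λ (θ * f) = θ * dMulti Λ f := by
  induction Λ using MIdx.induction with
  | h0 => simp
  | hs Λ l h =>
    rw [dMulti_add_single_apply, dMulti_add_single_apply, h, totalD_mul, totalD_constants hθ,
      zero_mul, zero_add]

/-- A constant passes through every `d_Λ` and out of the sum. No sign arises, since it stays on the
left throughout. -/
theorem prolong_constants_mul {θ : FPoly U ι κ Zb Zf} (hθ : θ ∈ constants U ι κ Zb Zf)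
    (v : Fld ι κ → FPoly U ι κ Zb Zf) (f : FPoly U ι κ Zb Zf) :
    prolong (fun i => θ * v i) f = θ * prolong v f := by
  rw [prolong, prolong, vert_apply, vert_apply, mul_finsum' _ _ (finite_support_mul_pd _ f)]
  exact finsum_congr fun p => by rw [dMulti_constants_mul hθ, mul_assoc]

/-! ## Matrices with values in a gauge Lie algebra -/

section GaugeMatrix

variable [DecidableEq ι] [Fintype κ] {R : Type*} [Ring R] [Algebra ℂ R]

namespace GaugeFrame

/-- Anti-Hermiticity makes `Tr(X† Y)` minus the trace form, which is where the sign in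
`sum_mul_eq_trace` comes from. -/
theorem trace_mul (G : GaugeFrame ι κ) (I J : ι) :
    Matrix.trace (G.mat I * G.mat J) = if I = J then -1 else 0 := by
  have h := G.orthonormal I J
  rw [G.antiHermitian, Matrix.neg_mul, Matrix.trace_neg, neg_eq_iff_eq_neg] at h
  rw [h]; split_ifs <;> simp

variable [Fintype ι]

/-- Closure under the bracket provides some real coefficients; pairing with the orthonormal frame
identifies them with the trace formula defining `c`. -/
theorem mat_commutator (G : GaugeFrame ι κ) (J H : ι) :
    G.mat J * G.mat H - G.mat H * G.mat J = ∑ I, G.c I J H • G.mat I := by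
  obtain ⟨a, ha⟩ := (Submodule.mem_span_range_iff_exists_fun ℝ).1 (G.bracket_mem J H)
  have hc : ∀ I, G.c I J H = a I := fun I => by
    rw [c, ← ha, Matrix.mul_sum, Matrix.trace_sum]
    simp only [Matrix.mul_smul, Matrix.trace_smul, G.orthonormal]
    simp
  rw [← ha]
  refine Finset.sum_congr rfl fun I _ => ?_
  rw [hc]
  ext i j
  simp

/-- The matrix `x^I 𝔩_I`. -/
def toMatrix (G : GaugeFrame ι κ) (x : ι → R) : Matrix κ κ R := fun i j => ∑ I, G.mat I i j • x I

/-- The bracket `c^I_{JH} x^J y^H`. -/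
def bracket (G : GaugeFrame ι κ) (x y : ι → R) (I : ι) : R := ∑ J, ∑ H, G.c I J H • (x J * y H)

theorem toMatrix_add (G : GaugeFrame ι κ) (x y : ι → R) :
    G.toMatrix (x + y) = G.toMatrix x + G.toMatrix y := by
  ext i j; simp [toMatrix, Finset.sum_add_distrib]

theorem toMatrix_sub (G : GaugeFrame ι κ) (x y : ι → R) :
    G.toMatrix (x - y) = G.toMatrix x - G.toMatrix y := by
  ext i j; simp [toMatrix, Finset.sum_sub_distrib, smul_sub]

theorem toMatrix_map (G : GaugeFrame ι κ) (T : R →ₗ[ℂ] R) (x : ι → R) :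
    (G.toMatrix x).map T = G.toMatrix (fun I => T (x I)) := by
  ext i j; simp [toMatrix]

/-- Pairing with the dual frame works for components in any algebra `R`, odd entries included.
Identities between components can therefore be proved between matrices, where the Jacobi identity is
hidden in associativity. -/
theorem toMatrix_inverse (G : GaugeFrame ι κ) (x : ι → R) (J : ι) :
    ∑ i, ∑ j, (G.mat J)ᴴ j i • G.toMatrix x i j = x J := by
  have h : ∀ I, ∑ i, ∑ j, ((G.mat J)ᴴ j i * G.mat I i j) • x I = if J = I then x I else 0 := by
    intro I
    simp only [← Finset.sum_smul]
    rw [Finset.sum_comm]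
    have := G.orthonormal J I
    simp only [Matrix.trace, Matrix.diag, Matrix.mul_apply] at this
    rw [this]
    split_ifs <;> simp
  simp only [toMatrix, Finset.smul_sum, smul_smul]
  rw [Finset.sum_congr rfl fun i _ => Finset.sum_comm, Finset.sum_comm]
  simp only [h]
  simp

theorem eq_zero_of_toMatrix (G : GaugeFrame ι κ) {x : ι → R} (h : G.toMatrix x = 0) (J : ι) :
    x J = 0 := by
  rw [← G.toMatrix_inverse x J, h]; simp

theorem toMatrix_mul (G : GaugeFrame ι κ) (x y : ι → R) (i j : κ) :
    (G.toMatrix x * G.toMatrix y) i j =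
      ∑ J, ∑ H, (G.mat J * G.mat H) i j • (x J * y H) := by
  simp only [Matrix.mul_apply, toMatrix, Finset.sum_mul_sum, Finset.sum_smul, smul_mul_smul_comm]
  rw [Finset.sum_comm]
  exact Finset.sum_congr rfl fun J _ => Finset.sum_comm

theorem toMatrix_bracket (G : GaugeFrame ι κ) (x y : ι → R) (i j : κ) :
    G.toMatrix (G.bracket x y) i j =
      ∑ J, ∑ H, (G.mat J * G.mat H - G.mat H * G.mat J) i j • (x J * y H) := by
  simp only [G.mat_commutator, toMatrix, bracket, Finset.smul_sum, smul_smul, Matrix.sum_apply,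
    Matrix.smul_apply, Finset.sum_smul, smul_eq_mul]
  rw [Finset.sum_comm]
  refine Finset.sum_congr rfl fun J _ => ?_
  rw [Finset.sum_comm]
  refine Finset.sum_congr rfl fun H _ => Finset.sum_congr rfl fun I _ => ?_
  rw [mul_comm]

theorem toMatrix_bracket_of_commute (G : GaugeFrame ι κ) {x y : ι → R}
    (h : ∀ J H, x J * y H = y H * x J) :
    G.toMatrix (G.bracket x y) = G.toMatrix x * G.toMatrix y - G.toMatrix y * G.toMatrix x := by
  ext i j
  rw [toMatrix_bracket, Matrix.sub_apply, toMatrix_mul, toMatrix_mul]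
  simp only [Matrix.sub_apply, sub_smul, Finset.sum_sub_distrib]
  congr 1
  rw [Finset.sum_comm]
  simp only [h]

/-- For odd components, the sign from exchanging `x J` and `x H` cancels the minus sign of the
commutator of frame matrices. The self-bracket is then twice the square, which need not vanish. -/
theorem toMatrix_bracket_of_anticommute (G : GaugeFrame ι κ) {x : ι → R}
    (h : ∀ J H, x J * x H = -(x H * x J)) :
    G.toMatrix (G.bracket x x) = G.toMatrix x * G.toMatrix x + G.toMatrix x * G.toMatrix x := by
  ext i j
  rw [toMatrix_bracket, Matrix.add_apply, toMatrix_mul]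
  simp only [Matrix.sub_apply, sub_smul, Finset.sum_sub_distrib]
  rw [sub_eq_add_neg]
  congr 1
  rw [Finset.sum_comm]
  simp only [← Finset.sum_neg_distrib, ← smul_neg, ← h]

/-- This rewrites the Euclidean contraction of gauge indices as a trace form, whose invariance under
commutators is what the gauge field Lagrangian needs. -/
theorem sum_mul_eq_trace (G : GaugeFrame ι κ) (x y : ι → R) :
    ∑ I, x I * y I = -Matrix.trace (G.toMatrix x * G.toMatrix y) := by
  simp only [Matrix.trace, Matrix.diag, toMatrix_mul]
  rw [Finset.sum_comm, ← Finset.sum_neg_distrib]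
  refine Finset.sum_congr rfl fun J _ => ?_
  rw [Finset.sum_comm]
  simp only [← Finset.sum_smul]
  have h := fun H => G.trace_mul J H
  simp only [Matrix.trace, Matrix.diag] at h
  simp [h, ite_smul]

end GaugeFrame

end GaugeMatrix

theorem IsSuperDer.map_matrix_mul {b : Bool} {D : FPoly U ι κ Zb Zf →ₗ[ℂ] FPoly U ι κ Zb Zf}
    (hD : IsSuperDer b D) {l m n : Type*} [Fintype m] (M : Matrix l m (FPoly U ι κ Zb Zf))
    (N : Matrix m n (FPoly U ι κ Zb Zf)) :
    (M * N).map D = M.map D * N + M.map (twist b) * N.map D := by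
  ext i j
  simp [Matrix.mul_apply, hD.leibniz, Finset.sum_add_distrib]

/-! ## The BRST transformation -/

section Brst

theorem hasParity_fA (l : Fin 4) (I : ι) : HasParity false (fA U ι κ Zb Zf l I) := hasParity_jet _ _
theorem hasParity_fn (I : ι) : HasParity false (fn U ι κ Zb Zf I) := hasParity_jet _ _
theorem hasParity_fpsi (α : Fin 4) (i : κ) : HasParity true (fpsi U ι κ Zb Zf α i) :=
  hasParity_jet _ _
theorem hasParity_fpsiBar (α : Fin 4) (i : κ) : HasParity true (fpsiBar U ι κ Zb Zf α i) :=
  hasParity_jet _ _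
theorem hasParity_fom (I : ι) : HasParity true (fom U ι κ Zb Zf I) := hasParity_jet _ _
theorem hasParity_fomBar (I : ι) : HasParity true (fomBar U ι κ Zb Zf I) := hasParity_jet _ _

theorem map_totalD_mul [Fintype κ] (l : Fin 4) (M N : Matrix κ κ (FPoly U ι κ Zb Zf)) :
    (M * N).map (totalD l) = M.map (totalD l) * N + M * N.map (totalD l) :=
  (isSuperDer_totalD l).map_matrix_mul M N

variable [Fintype ι] [DecidableEq ι] [Fintype κ]

theorem hasParity_omCov (G : GaugeFrame ι κ) (l : Fin 4) (I : ι) :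
    HasParity true (omCov G l I : FPoly U ι κ Zb Zf) :=
  ((hasParity_fom I).totalD l).add <| HasParity.sum fun J _ => HasParity.sum fun H _ =>
    ((hasParity_fom J).mul (hasParity_fA l H)).smul _

theorem hasParity_vBrst (G : GaugeFrame ι κ) (i : Fld ι κ) :
    HasParity (true ^^ i.isRight) (vBrst U Zb Zf G i) := by
  rcases i with (⟨l, I⟩ | I) | (⟨α, i⟩ | ⟨α, i⟩ | I | I)
  · exact hasParity_omCov G l I
  · exact HasParity.zero
  · exact HasParity.sum fun I _ => HasParity.sum fun j _ =>
      ((hasParity_fom I).mul (hasParity_fpsi α j)).smul _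
  · exact HasParity.sum fun I _ => HasParity.sum fun j _ =>
      ((hasParity_fpsiBar α j).mul (hasParity_fom I)).smul _
  · exact HasParity.sum fun J _ => HasParity.sum fun H _ =>
      ((hasParity_fom J).mul (hasParity_fom H)).smul _
  · exact hasParity_fn I

theorem isSuperDer_brst (G : GaugeFrame ι κ) : IsSuperDer true (brst U Zb Zf G) :=
  isSuperDer_prolong (hasParity_vBrst G)

theorem brst_mul (G : GaugeFrame ι κ) (f g : FPoly U ι κ Zb Zf) :
    brst U Zb Zf G (f * g) = brst U Zb Zf G f * g + parity f * brst U Zb Zf G g :=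
  (isSuperDer_brst G).leibniz f g

@[simp] theorem brst_coef (G : GaugeFrame ι κ) (s : Smooth U) :
    brst U Zb Zf G (coef s) = 0 := prolong_coef _ _

theorem brst_coef_mul (G : GaugeFrame ι κ) (s : Smooth U) (f : FPoly U ι κ Zb Zf) :
    brst U Zb Zf G (coef s * f) = coef s * brst U Zb Zf G f := by
  rw [brst_mul, brst_coef, zero_mul, zero_add, parity_coef]

theorem brst_mul_coef (G : GaugeFrame ι κ) (s : Smooth U) (f : FPoly U ι κ Zb Zf) :
    brst U Zb Zf G (f * coef s) = brst U Zb Zf G f * coef s := by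
  rw [← coef_comm, brst_coef_mul, coef_comm]

theorem brst_jet_zero (G : GaugeFrame ι κ) (i : Fld ι κ) :
    brst U Zb Zf G (jet i 0) = vBrst U Zb Zf G i := by
  rw [brst, prolong_jet, dMulti_zero]

theorem brst_totalD (G : GaugeFrame ι κ) (l : Fin 4) (f : FPoly U ι κ Zb Zf) :
    brst U Zb Zf G (totalD l f) = totalD l (brst U Zb Zf G f) :=
  prolong_totalD (hasParity_vBrst G) l f

/-- The matrix `ω = ω^I 𝔩_I`. -/
def omMat (U : TopologicalSpace.Opens Pt) (Zb Zf : Type) (G : GaugeFrame ι κ) :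
    Matrix κ κ (FPoly U ι κ Zb Zf) := G.toMatrix (fom U ι κ Zb Zf)

/-- The matrix `A_l = A_l^I 𝔩_I`. -/
def aMat (U : TopologicalSpace.Opens Pt) (Zb Zf : Type) (G : GaugeFrame ι κ) (l : Fin 4) :
    Matrix κ κ (FPoly U ι κ Zb Zf) := G.toMatrix (fA U ι κ Zb Zf l)

theorem map_parity_omMat (G : GaugeFrame ι κ) :
    (omMat U Zb Zf G).map parity = -omMat U Zb Zf G := by
  rw [omMat, GaugeFrame.toMatrix_map]
  ext i j
  simp [GaugeFrame.toMatrix, hasParity_true.1 (hasParity_fom _)]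

theorem map_parity_aMat (G : GaugeFrame ι κ) (l : Fin 4) :
    (aMat U Zb Zf G l).map parity = aMat U Zb Zf G l := by
  rw [aMat, GaugeFrame.toMatrix_map]
  simp only [hasParity_false.1 (hasParity_fA _ _)]

theorem map_brst_totalD (G : GaugeFrame ι κ) (l : Fin 4) (M : Matrix κ κ (FPoly U ι κ Zb Zf)) :
    (M.map (totalD l)).map (brst U Zb Zf G) = (M.map (brst U Zb Zf G)).map (totalD l) := by
  ext i j; simp [brst_totalD]

/-- The factor `1/2` in the ghost component of `v̆` absorbs the two in
`toMatrix_bracket_of_anticommute`. -/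
theorem map_brst_omMat (G : GaugeFrame ι κ) :
    (omMat U Zb Zf G).map (brst U Zb Zf G) = omMat U Zb Zf G * omMat U Zb Zf G := by
  have h : (fun I => brst U Zb Zf G (fom U ι κ Zb Zf I)) =
      (1 / 2 : ℂ) • G.bracket (fom U ι κ Zb Zf) (fom U ι κ Zb Zf) := by
    ext I
    rw [fom, brst_jet_zero]
    simp only [vBrst, Pi.smul_apply, GaugeFrame.bracket, Finset.smul_sum, smul_smul]
  have h2 := G.toMatrix_bracket_of_anticommute (x := fom U ι κ Zb Zf) fun J H => by
    rw [(hasParity_fom J).supercomm, twist_true, hasParity_true.1 (hasParity_fom H), neg_mul]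
  rw [omMat, GaugeFrame.toMatrix_map, h]
  have h3 : ∀ x : ι → FPoly U ι κ Zb Zf,
      G.toMatrix ((1 / 2 : ℂ) • x) = (1 / 2 : ℂ) • G.toMatrix x := fun x => by
    ext i j
    simp only [GaugeFrame.toMatrix, Matrix.smul_apply, Finset.smul_sum, Pi.smul_apply]
    exact Finset.sum_congr rfl fun I _ => smul_comm _ _ _
  rw [h3, h2, ← two_smul ℂ (G.toMatrix _ * _), smul_smul]
  norm_num

theorem map_brst_aMat (G : GaugeFrame ι κ) (l : Fin 4) :
    (aMat U Zb Zf G l).map (brst U Zb Zf G) = (omMat U Zb Zf G).map (totalD l) +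
      (omMat U Zb Zf G * aMat U Zb Zf G l - aMat U Zb Zf G l * omMat U Zb Zf G) := by
  have h : (fun I => brst U Zb Zf G (fA U ι κ Zb Zf l I)) =
      (fun I => totalD l (fom U ι κ Zb Zf I)) +
        G.bracket (fom U ι κ Zb Zf) (fA U ι κ Zb Zf l) := by
    ext I
    rw [fA, brst_jet_zero]
    rfl
  rw [aMat, GaugeFrame.toMatrix_map, h, GaugeFrame.toMatrix_add, G.toMatrix_bracket_of_commute,
    omMat, GaugeFrame.toMatrix_map]
  exact fun J H => ((hasParity_fA l H).even_comm _).symm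

theorem brst_fpsi (G : GaugeFrame ι κ) (α : Fin 4) (i : κ) :
    brst U Zb Zf G (fpsi U ι κ Zb Zf α i) = (omMat U Zb Zf G *ᵥ fpsi U ι κ Zb Zf α) i := by
  rw [fpsi, brst_jet_zero]
  simp only [vBrst, Matrix.mulVec, dotProduct, omMat, GaugeFrame.toMatrix, Finset.sum_mul,
    smul_mul_assoc]
  exact Finset.sum_comm

theorem brst_fpsiBar (G : GaugeFrame ι κ) (α : Fin 4) (i : κ) :
    brst U Zb Zf G (fpsiBar U ι κ Zb Zf α i) = (fpsiBar U ι κ Zb Zf α ᵥ* omMat U Zb Zf G) i := by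
  rw [fpsiBar, brst_jet_zero]
  simp only [vBrst, Matrix.vecMul, dotProduct, omMat, GaugeFrame.toMatrix, Finset.mul_sum,
    mul_smul_comm]
  exact Finset.sum_comm

theorem brst_mulVec (G : GaugeFrame ι κ) (M : Matrix κ κ (FPoly U ι κ Zb Zf))
    (x : κ → FPoly U ι κ Zb Zf) (i : κ) :
    brst U Zb Zf G ((M *ᵥ x) i) = (M.map (brst U Zb Zf G) *ᵥ x) i +
      (M.map parity *ᵥ fun j => brst U Zb Zf G (x j)) i := by
  simp [Matrix.mulVec, dotProduct, brst_mul, Finset.sum_add_distrib]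

theorem brst_vecMul (G : GaugeFrame ι κ) (M : Matrix κ κ (FPoly U ι κ Zb Zf))
    (x : κ → FPoly U ι κ Zb Zf) (i : κ) :
    brst U Zb Zf G ((x ᵥ* M) i) = ((fun j => brst U Zb Zf G (x j)) ᵥ* M) i +
      ((fun j => parity (x j)) ᵥ* M.map (brst U Zb Zf G)) i := by
  simp [Matrix.vecMul, dotProduct, brst_mul, Finset.sum_add_distrib]

/-- In matrix form `S(ωω) = (ωω)ω - ω(ωω)`, the minus sign being that of the odd `ω`; associativity
makes it vanish. -/
theorem brst_brst_fom (G : GaugeFrame ι κ) (I : ι) :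
    brst U Zb Zf G (brst U Zb Zf G (fom U ι κ Zb Zf I)) = 0 := by
  refine G.eq_zero_of_toMatrix (x := fun I => brst U Zb Zf G (brst U Zb Zf G (fom U ι κ Zb Zf I)))
    ?_ I
  rw [← GaugeFrame.toMatrix_map, ← GaugeFrame.toMatrix_map]
  change ((omMat U Zb Zf G).map _).map _ = 0
  rw [map_brst_omMat, (isSuperDer_brst G).map_matrix_mul]
  change _ + (omMat U Zb Zf G).map parity * _ = 0
  rw [map_brst_omMat, map_parity_omMat, Matrix.neg_mul, Matrix.mul_assoc, add_neg_cancel]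

theorem brst_brst_fA (G : GaugeFrame ι κ) (l : Fin 4) (I : ι) :
    brst U Zb Zf G (brst U Zb Zf G (fA U ι κ Zb Zf l I)) = 0 := by
  classical
  refine G.eq_zero_of_toMatrix
    (x := fun I => brst U Zb Zf G (brst U Zb Zf G (fA U ι κ Zb Zf l I))) ?_ I
  rw [← GaugeFrame.toMatrix_map, ← GaugeFrame.toMatrix_map]
  change ((aMat U Zb Zf G l).map _).map _ = 0
  -- Here `w`, `dw`, `a` stand for `ω`, `d_l ω`, `A_l`. The first two terms are `S d_l ω = d_l(ωω)`,
  -- and `-w` is `ω` after the parity involution.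
  have key : ∀ {M : Type} [Ring M] (w dw a : M), dw * w + w * dw + (w * w * a + -w * (dw + (w * a - a * w)) -
    ((dw + (w * a - a * w)) * w + a * (w * w))) = 0 := by
    intros; noncomm_ring
  rw [map_brst_aMat, Matrix.map_add _ (map_add _), Matrix.map_sub _ (map_sub _),
    map_brst_totalD, map_brst_omMat, map_totalD_mul, (isSuperDer_brst G).map_matrix_mul,
    (isSuperDer_brst G).map_matrix_mul]
  change _ + (_ + (omMat U Zb Zf G).map parity * _ - (_ + (aMat U Zb Zf G l).map parity * _)) = 0
  rw [map_parity_omMat, map_parity_aMat, map_brst_omMat, map_brst_aMat]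
  exact key _ _ _

theorem brst_brst_fpsi (G : GaugeFrame ι κ) (α : Fin 4) (i : κ) :
    brst U Zb Zf G (brst U Zb Zf G (fpsi U ι κ Zb Zf α i)) = 0 := by
  rw [brst_fpsi, brst_mulVec, map_brst_omMat, map_parity_omMat]
  simp only [brst_fpsi]
  change _ + (-omMat U Zb Zf G *ᵥ (omMat U Zb Zf G *ᵥ fpsi U ι κ Zb Zf α)) i = 0
  rw [Matrix.neg_mulVec, Matrix.mulVec_mulVec, Pi.neg_apply, add_neg_cancel]

theorem brst_brst_fpsiBar (G : GaugeFrame ι κ) (α : Fin 4) (i : κ) :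
    brst U Zb Zf G (brst U Zb Zf G (fpsiBar U ι κ Zb Zf α i)) = 0 := by
  rw [brst_fpsiBar, brst_vecMul, map_brst_omMat]
  simp only [brst_fpsiBar, hasParity_true.1 (hasParity_fpsiBar _ _)]
  change ((fpsiBar U ι κ Zb Zf α ᵥ* omMat U Zb Zf G) ᵥ* omMat U Zb Zf G) i +
    (-fpsiBar U ι κ Zb Zf α ᵥ* _) i = 0
  rw [Matrix.neg_vecMul, Matrix.vecMul_vecMul, Pi.neg_apply, add_neg_cancel]

theorem brst_vBrst (G : GaugeFrame ι κ) (i : Fld ι κ) :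
    brst U Zb Zf G (vBrst U Zb Zf G i) = 0 := by
  rw [← brst_jet_zero]
  rcases i with (⟨l, I⟩ | I) | (⟨α, i⟩ | ⟨α, i⟩ | I | I)
  · exact brst_brst_fA G l I
  · rw [brst_jet_zero]; exact map_zero _
  · exact brst_brst_fpsi G α i
  · exact brst_brst_fpsiBar G α i
  · exact brst_brst_fom G I
  · rw [brst_jet_zero]
    exact (brst_jet_zero G (.inl (.n I))).trans rfl

/-- Since `S` commutes with `d_Λ`, nilpotency on `y^i_Λ` is the `d_Λ`-derivative of `S v̆^i = 0`. -/
theorem brst_brst (G : GaugeFrame ι κ) (f : FPoly U ι κ Zb Zf) :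
    brst U Zb Zf G (brst U Zb Zf G f) = 0 := by
  refine (isSuperDer_brst G).sq_eq_zero (fun s => ?_) (fun z => ?_) (fun z => ?_)
    (fun i Λ => ?_) f
  · simp
  · rw [brst, prolong_evenVar_inl, map_zero]
  · rw [brst, prolong_oddVar_inl, map_zero]
  · rw [brst, prolong_jet, prolong_dMulti (hasParity_vBrst G)]
    exact (congrArg _ (brst_vBrst G i)).trans (map_zero _)

end Brst

/-! ## Gauge invariance of the matter and gauge field Lagrangian -/

section Lagrangian

/-- Spinor indices are acted on by coefficient functions, which are central, so these operations
commute with the gauge matrices. -/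
theorem mulVec_sum_coef [Fintype κ] (M : Matrix κ κ (FPoly U ι κ Zb Zf)) {J : Type*} [Fintype J]
    (s : J → Smooth U) (x : J → κ → FPoly U ι κ Zb Zf) (i : κ) :
    (M *ᵥ fun j => ∑ β, coef (s β) * x β j) i = ∑ β, coef (s β) * (M *ᵥ x β) i := by
  simp only [Matrix.mulVec, dotProduct, Finset.mul_sum]
  rw [Finset.sum_comm]
  refine Finset.sum_congr rfl fun β _ => Finset.sum_congr rfl fun j _ => ?_
  rw [← mul_assoc, ← coef_comm, mul_assoc]

theorem vecMul_sum_coef [Fintype κ] (M : Matrix κ κ (FPoly U ι κ Zb Zf)) {J : Type*} [Fintype J]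
    (s : J → Smooth U) (x : J → κ → FPoly U ι κ Zb Zf) (i : κ) :
    ((fun j => ∑ β, x β j * coef (s β)) ᵥ* M) i = ∑ β, (x β ᵥ* M) i * coef (s β) := by
  simp only [Matrix.vecMul, dotProduct, Finset.sum_mul]
  rw [Finset.sum_comm]
  refine Finset.sum_congr rfl fun β _ => Finset.sum_congr rfl fun j _ => ?_
  rw [mul_assoc, coef_comm, mul_assoc]

theorem totalD_mulVec [Fintype κ] (l : Fin 4) (M : Matrix κ κ (FPoly U ι κ Zb Zf))
    (x : κ → FPoly U ι κ Zb Zf) (i : κ) :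
    totalD l ((M *ᵥ x) i) = (M.map (totalD l) *ᵥ x) i + (M *ᵥ fun j => totalD l (x j)) i := by
  simp [Matrix.mulVec, dotProduct, totalD_mul, Finset.sum_add_distrib]

theorem totalD_vecMul [Fintype κ] (l : Fin 4) (M : Matrix κ κ (FPoly U ι κ Zb Zf))
    (x : κ → FPoly U ι κ Zb Zf) (i : κ) :
    totalD l ((x ᵥ* M) i) = ((fun j => totalD l (x j)) ᵥ* M) i + (x ᵥ* M.map (totalD l)) i := by
  simp [Matrix.vecMul, dotProduct, totalD_mul, Finset.sum_add_distrib]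

variable [Fintype ι] [DecidableEq ι] [Fintype κ]

theorem covPsi_eq (B : Background U) (G : GaugeFrame ι κ) (l α : Fin 4) :
    covPsi Zb Zf B G l α = (fun i => totalD l (fpsi U ι κ Zb Zf α i)) -
      (fun i => ∑ β, coef (B.spinConn l α β) * fpsi U ι κ Zb Zf β i) -
      aMat U Zb Zf G l *ᵥ fpsi U ι κ Zb Zf α := by
  ext i
  simp only [covPsi, Pi.sub_apply, Matrix.mulVec, dotProduct, aMat, GaugeFrame.toMatrix,
    Finset.sum_mul, smul_mul_assoc]
  rw [Finset.sum_comm]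

theorem covPsiBar_eq (B : Background U) (G : GaugeFrame ι κ) (l α : Fin 4) :
    covPsiBar Zb Zf B G l α = (fun i => totalD l (fpsiBar U ι κ Zb Zf α i)) +
      (fun i => ∑ β, fpsiBar U ι κ Zb Zf β i * coef (B.spinConn l β α)) +
      fpsiBar U ι κ Zb Zf α ᵥ* aMat U Zb Zf G l := by
  ext i
  simp only [covPsiBar, Pi.add_apply, Matrix.vecMul, dotProduct, aMat, GaugeFrame.toMatrix,
    Finset.mul_sum, mul_smul_comm]
  rw [Finset.sum_comm]

/-- The term `(d_l ω)ψ` of `d_l(ωψ)` cancels against the inhomogeneous part of `SA_l`, and the two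
terms `A_l ωψ` cancel each other because `A_l` is even. What remains is `ω` acting on `∇_l ψ`. -/
theorem brst_covPsi (B : Background U) (G : GaugeFrame ι κ) (l α : Fin 4) (i : κ) :
    brst U Zb Zf G (covPsi Zb Zf B G l α i) = (omMat U Zb Zf G *ᵥ covPsi Zb Zf B G l α) i := by
  rw [covPsi_eq, Matrix.mulVec_sub, Matrix.mulVec_sub]
  simp only [Pi.sub_apply, map_sub, map_sum, brst_coef_mul, brst_totalD, brst_fpsi,
    totalD_mulVec, mulVec_sum_coef, brst_mulVec, map_brst_aMat, map_parity_aMat]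
  change _ - _ - (_ + (aMat U Zb Zf G l *ᵥ (omMat U Zb Zf G *ᵥ fpsi U ι κ Zb Zf α)) i) = _
  simp only [Matrix.add_mulVec, Matrix.sub_mulVec, Matrix.mulVec_mulVec, Pi.add_apply,
    Pi.sub_apply]
  abel

/-- Dual cancellation: here `S` passes the odd `ψ̄` before reaching `A_l`, and the resulting minus
sign removes `ψ̄ d_l ω` and `ψ̄ωA_l`. -/
theorem brst_covPsiBar (B : Background U) (G : GaugeFrame ι κ) (l α : Fin 4) (i : κ) :
    brst U Zb Zf G (covPsiBar Zb Zf B G l α i) =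
      (covPsiBar Zb Zf B G l α ᵥ* omMat U Zb Zf G) i := by
  rw [covPsiBar_eq, Matrix.add_vecMul, Matrix.add_vecMul]
  simp only [Pi.add_apply, map_add, map_sum, brst_mul_coef, brst_totalD, brst_fpsiBar,
    totalD_vecMul, vecMul_sum_coef, brst_vecMul, map_brst_aMat,
    hasParity_true.1 (hasParity_fpsiBar _ _)]
  change _ + _ + (((fpsiBar U ι κ Zb Zf α ᵥ* omMat U Zb Zf G) ᵥ* aMat U Zb Zf G l) i +
    (-fpsiBar U ι κ Zb Zf α ᵥ* _) i) = _
  simp only [Matrix.vecMul_add, Matrix.vecMul_sub, Matrix.vecMul_vecMul, Matrix.neg_vecMul,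
    Pi.neg_apply, Pi.add_apply, Pi.sub_apply]
  abel

theorem brst_slashPsi (B : Background U) (G : GaugeFrame ι κ) (α : Fin 4) (i : κ) :
    brst U Zb Zf G (slashPsi Zb Zf B G α i) = (omMat U Zb Zf G *ᵥ slashPsi Zb Zf B G α) i := by
  have h : slashPsi Zb Zf B G α = fun i => ∑ p : Fin 4 × Fin 4,
      coef (B.gammaUp p.1 α p.2) * covPsi Zb Zf B G p.1 p.2 i := by
    ext i; rw [slashPsi, Fintype.sum_prod_type]
  rw [h, mulVec_sum_coef]
  simp only [map_sum, brst_coef_mul, brst_covPsi]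

theorem brst_slashPsiBar (B : Background U) (G : GaugeFrame ι κ) (α : Fin 4) (i : κ) :
    brst U Zb Zf G (slashPsiBar Zb Zf B G α i) =
      (slashPsiBar Zb Zf B G α ᵥ* omMat U Zb Zf G) i := by
  have h : slashPsiBar Zb Zf B G α = fun i => ∑ p : Fin 4 × Fin 4,
      covPsiBar Zb Zf B G p.1 p.2 i * coef (B.gammaUp p.1 p.2 α) := by
    ext i; rw [slashPsiBar, Fintype.sum_prod_type]
  rw [h, vecMul_sum_coef]
  simp only [map_sum, brst_mul_coef, brst_covPsiBar]

theorem hasParity_covPsiBar (B : Background U) (G : GaugeFrame ι κ) (l α : Fin 4) (i : κ) :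
    HasParity true (covPsiBar Zb Zf B G l α i) :=
  (((hasParity_fpsiBar α i).totalD l).add <| HasParity.sum fun β _ =>
    (hasParity_fpsiBar β i).mul (hasParity_coef _)).add <| HasParity.sum fun I _ =>
      HasParity.sum fun j _ => ((hasParity_fpsiBar α j).mul (hasParity_fA l I)).smul _

theorem hasParity_slashPsiBar (B : Background U) (G : GaugeFrame ι κ) (α : Fin 4) (i : κ) :
    HasParity true (slashPsiBar Zb Zf B G α i) :=
  HasParity.sum fun l _ => HasParity.sum fun β _ =>
    (hasParity_covPsiBar B G l β i).mul (hasParity_coef _)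

/-- The contraction of a gauge covariant object with a dual one is invariant. -/
theorem brst_dotProduct {G : GaugeFrame ι κ} {x y : κ → FPoly U ι κ Zb Zf}
    (hx : ∀ i, HasParity true (x i))
    (hSx : ∀ i, brst U Zb Zf G (x i) = (x ᵥ* omMat U Zb Zf G) i)
    (hSy : ∀ i, brst U Zb Zf G (y i) = (omMat U Zb Zf G *ᵥ y) i) :
    brst U Zb Zf G (∑ i, x i * y i) = 0 := by
  -- As `x` is odd, the Leibniz rule gives `(xω)y - x(ωy)`, which vanishes by associativity.
  have h : (x ᵥ* omMat U Zb Zf G) ⬝ᵥ y - x ⬝ᵥ (omMat U Zb Zf G *ᵥ y) = 0 := by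
    rw [Matrix.dotProduct_mulVec, sub_self]
  rw [← h]
  simp only [map_sum, brst_mul, hSx, hSy, hasParity_true.1 (hx _), neg_mul, dotProduct,
    Finset.sum_add_distrib, Finset.sum_neg_distrib, sub_eq_add_neg]

theorem brst_ellPsi (B : Background U) (G : GaugeFrame ι κ) (mass : ℝ) :
    brst U Zb Zf G (ellPsi Zb Zf B G mass) = 0 := by
  have h1 := fun α => brst_dotProduct (hasParity_fpsiBar α) (brst_fpsiBar (Zb := Zb) (Zf := Zf) G α)
    (brst_slashPsi B G α)
  have h2 := fun α => brst_dotProduct (hasParity_slashPsiBar (Zb := Zb) (Zf := Zf) B G α)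
    (brst_slashPsiBar B G α) (brst_fpsi G α)
  have h3 := fun α => brst_dotProduct (hasParity_fpsiBar (U := U) (Zb := Zb) (Zf := Zf) α)
    (brst_fpsiBar G α) (brst_fpsi G α)
  rw [ellPsi, brst_mul_coef]
  simp only [smul_sub, Finset.sum_sub_distrib, ← Finset.smul_sum]
  simp only [map_sub, map_smul, map_sum (brst U Zb Zf G) _ (Finset.univ : Finset (Fin 4)), h1,
    h2, h3, Finset.sum_const_zero, smul_zero, sub_zero, zero_mul]

/-- The matrix `F_{lm} = F_{lm}^I 𝔩_I`. -/
def curvMat (U : TopologicalSpace.Opens Pt) (Zb Zf : Type) (G : GaugeFrame ι κ) (l m : Fin 4) :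
    Matrix κ κ (FPoly U ι κ Zb Zf) := G.toMatrix (curv Zb Zf U G l m)

theorem hasParity_curv (G : GaugeFrame ι κ) (l m : Fin 4) (I : ι) :
    HasParity false (curv Zb Zf U G l m I) :=
  (((hasParity_fA l I).totalD m).sub ((hasParity_fA m I).totalD l)).add <|
    HasParity.sum fun J _ => HasParity.sum fun H _ =>
      ((hasParity_fA l J).mul (hasParity_fA m H)).smul _

theorem hasParity_curvMat (G : GaugeFrame ι κ) (l m : Fin 4) (i j : κ) :
    HasParity false (curvMat U Zb Zf G l m i j) :=
  HasParity.sum fun I _ => (hasParity_curv G l m I).smul _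

theorem curvMat_eq (G : GaugeFrame ι κ) (l m : Fin 4) :
    curvMat U Zb Zf G l m = (aMat U Zb Zf G l).map (totalD m) - (aMat U Zb Zf G m).map (totalD l) +
      (aMat U Zb Zf G l * aMat U Zb Zf G m - aMat U Zb Zf G m * aMat U Zb Zf G l) := by
  have h : curv Zb Zf U G l m = (fun I => totalD m (fA U ι κ Zb Zf l I)) -
      (fun I => totalD l (fA U ι κ Zb Zf m I)) +
        G.bracket (fA U ι κ Zb Zf l) (fA U ι κ Zb Zf m) := rfl
  rw [curvMat, h, GaugeFrame.toMatrix_add, GaugeFrame.toMatrix_sub, G.toMatrix_bracket_of_commute,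
    aMat, aMat, GaugeFrame.toMatrix_map, GaugeFrame.toMatrix_map]
  exact fun J H => (hasParity_fA l J).even_comm _

theorem map_brst_curvMat (G : GaugeFrame ι κ) (l m : Fin 4) :
    (curvMat U Zb Zf G l m).map (brst U Zb Zf G) =
      omMat U Zb Zf G * curvMat U Zb Zf G l m - curvMat U Zb Zf G l m * omMat U Zb Zf G := by
  classical
  -- Here `a`, `b` are `A_l`, `A_m`; `wl`, `wm`, `wml` are derivatives of `ω`; and `am`, `bl` are
  -- `d_m A_l`, `d_l A_m`. The mixed derivative `wml` occurs twice because total derivatives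
  -- commute, and drops out.
  have key : ∀ {M : Type} [Ring M] (w a b wl wm wml am bl : M),
      (wml + (wm * a + w * am - (am * w + a * wm))) -
        (wml + (wl * b + w * bl - (bl * w + b * wl))) +
      (((wl + (w * a - a * w)) * b + a * (wm + (w * b - b * w))) -
        ((wm + (w * b - b * w)) * a + b * (wl + (w * a - a * w)))) =
      w * (am - bl + (a * b - b * a)) - (am - bl + (a * b - b * a)) * w := by
    intros; noncomm_ring
  have h1 : ((omMat U Zb Zf G).map (totalD m)).map (totalD l) =
      ((omMat U Zb Zf G).map (totalD l)).map (totalD m) := by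
    ext i j; exact totalD_comm _ _ _
  have h2 : ∀ a b : Fin 4, (aMat U Zb Zf G a * aMat U Zb Zf G b).map (brst U Zb Zf G) =
      (aMat U Zb Zf G a).map (brst U Zb Zf G) * aMat U Zb Zf G b +
        aMat U Zb Zf G a * (aMat U Zb Zf G b).map (brst U Zb Zf G) := fun a b => by
    rw [(isSuperDer_brst G).map_matrix_mul]
    change _ + (aMat U Zb Zf G a).map parity * _ = _
    rw [map_parity_aMat]
  rw [curvMat_eq, Matrix.map_add _ (map_add _), Matrix.map_sub _ (map_sub _),
    Matrix.map_sub _ (map_sub _), h2, h2, map_brst_totalD, map_brst_totalD, map_brst_aMat,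
    map_brst_aMat, Matrix.map_add _ (map_add _), Matrix.map_sub _ (map_sub _),
    Matrix.map_add _ (map_add _), Matrix.map_sub _ (map_sub _), map_totalD_mul, map_totalD_mul,
    map_totalD_mul, map_totalD_mul, h1]
  exact key _ _ _ _ _ _ _ _

theorem brst_sum_curv_mul (G : GaugeFrame ι κ) (l p m q : Fin 4) :
    brst U Zb Zf G (∑ I, curv Zb Zf U G l p I * curv Zb Zf U G m q I) = 0 := by
  classical
  have key : ∀ {M : Type} [Ring M] (w a b : M),
      (w * a - a * w) * b + a * (w * b - b * w) = w * (a * b) - (a * b) * w := by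
    intros; noncomm_ring
  have h : brst U Zb Zf G (Matrix.trace (curvMat U Zb Zf G l p * curvMat U Zb Zf G m q)) =
      Matrix.trace ((curvMat U Zb Zf G l p * curvMat U Zb Zf G m q).map (brst U Zb Zf G)) := by
    simp [Matrix.trace]
  have hp : (curvMat U Zb Zf G l p).map (twist true) = curvMat U Zb Zf G l p := by
    ext i j; exact hasParity_curvMat G l p i j
  rw [G.sum_mul_eq_trace, map_neg]
  change -brst U Zb Zf G (Matrix.trace (curvMat U Zb Zf G l p * curvMat U Zb Zf G m q)) = 0
  rw [h, (isSuperDer_brst G).map_matrix_mul, hp, map_brst_curvMat, map_brst_curvMat, key,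
    Matrix.trace_sub, neg_eq_zero, sub_eq_zero]
  -- Cyclicity of the trace is not automatic over a noncommutative ring. It holds here because the
  -- entries of the product of curvatures are even, hence commute with the entries of `ω`.
  simp only [Matrix.trace, Matrix.diag, Matrix.mul_apply (M := omMat U Zb Zf G),
    Matrix.mul_apply (N := omMat U Zb Zf G)]
  rw [Finset.sum_comm]
  refine Finset.sum_congr rfl fun i _ => Finset.sum_congr rfl fun j _ => ?_
  refine (HasParity.even_comm ?_ _).symm
  exact HasParity.sum fun k _ => (hasParity_curvMat G l p _ _).mul (hasParity_curvMat G m q _ _)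

theorem brst_ellA (B : Background U) (G : GaugeFrame ι κ) :
    brst U Zb Zf G (ellA Zb Zf B G) = 0 := by
  simp only [ellA, ← Finset.mul_sum, map_smul]
  simp only [map_sum (brst U Zb Zf G) _ (Finset.univ : Finset (Fin 4)), brst_coef_mul,
    brst_sum_curv_mul, mul_zero, Finset.sum_const_zero, smul_zero]

theorem brst_ell0 (B : Background U) (G : GaugeFrame ι κ) (mass : ℝ) :
    brst U Zb Zf G (ell0 Zb Zf B G mass) = 0 := by
  rw [ell0, map_add, brst_ellPsi, brst_ellA, add_zero]

end Lagrangian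

/-! ## Horizontal forms of degree three and four -/

theorem dx_mul_self (l : Fin 4) : dx l * dx l = 0 := ExteriorAlgebra.ι_sq_zero _

theorem dx_anticomm (l m : Fin 4) : dx l * dx m = -(dx m * dx l) :=
  eq_neg_of_add_eq_zero_left (ExteriorAlgebra.ι_add_mul_swap _ _)

theorem dx_mul_d4x (l : Fin 4) : dx l * d4x = 0 := by
  have h : ∀ a b : ExteriorAlgebra ℂ (Fin 4 → ℂ), a * b = -(b * a) → a * a = 0 → ∀ c,
      a * (b * (a * c)) = 0 := fun a b hab ha c => by
    rw [← mul_assoc, hab, neg_mul, mul_assoc, ← mul_assoc a a, ha, zero_mul, mul_zero, neg_zero]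
  have h2 : ∀ a b : ExteriorAlgebra ℂ (Fin 4 → ℂ), a * b = -(b * a) → ∀ c,
      a * (b * c) = -(b * (a * c)) := fun a b hab c => by
    rw [← mul_assoc, hab, neg_mul, mul_assoc]
  simp only [d4x, mul_assoc]
  obtain rfl | rfl | rfl | rfl : l = 0 ∨ l = 1 ∨ l = 2 ∨ l = 3 := by fin_cases l <;> simp
  · rw [← mul_assoc, dx_mul_self, zero_mul]
  · exact h _ _ (dx_anticomm _ _) (dx_mul_self _) _
  · rw [h2 _ _ (dx_anticomm 2 0), h _ _ (dx_anticomm _ _) (dx_mul_self _), mul_zero, neg_zero]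
  · rw [h2 _ _ (dx_anticomm 3 0), h2 _ _ (dx_anticomm 3 1), dx_anticomm 2 3, mul_neg (dx 3),
      ← mul_assoc (dx 3), dx_mul_self]
    simp

/-- Contracting the vanishing 5-form `dx l * d4x` with the `m`-th coordinate functional gives the
relation at once. -/
theorem dx_mul_dxLow (l m : Fin 4) : dx l * dxLow m = if l = m then d4x else 0 := by
  have h := congrArg (CliffordAlgebra.contractLeft (Q := 0) (LinearMap.proj m)) (dx_mul_d4x l)
  rw [map_zero, dx, ExteriorAlgebra.ι, CliffordAlgebra.contractLeft_ι_mul, sub_eq_zero] at h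
  refine h.symm.trans ?_
  rw [LinearMap.proj_apply, Pi.single_apply]
  split_ifs with h1 h2 h2
  · exact one_smul _ _
  · exact absurd h1.symm h2
  · exact absurd h2.symm h1
  · exact zero_smul _ _

/-- The form `d⁴x` does not vanish: some linear functional takes the value one on it. -/
theorem exists_dual_d4x : ∃ φ : ExteriorAlgebra ℂ (Fin 4 → ℂ) →ₗ[ℂ] ℂ, φ d4x = 1 := by
  have hc : ∀ (l m : Fin 4) (x : ExteriorAlgebra ℂ (Fin 4 → ℂ)),
      CliffordAlgebra.contractLeft (Q := 0) (LinearMap.proj l) (dx m * x) =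
        (if l = m then (1 : ℂ) else 0) • x -
          dx m * CliffordAlgebra.contractLeft (Q := 0) (LinearMap.proj l) x := fun l m x => by
    rw [dx, ExteriorAlgebra.ι, CliffordAlgebra.contractLeft_ι_mul, LinearMap.proj_apply,
      Pi.single_apply]
  have h1 : ∀ (l m : Fin 4),
      CliffordAlgebra.contractLeft (Q := 0) (LinearMap.proj l) (dx m) =
        algebraMap ℂ _ (if l = m then (1 : ℂ) else 0) := fun l m => by
    rw [dx, ExteriorAlgebra.ι, CliffordAlgebra.contractLeft_ι, LinearMap.proj_apply,
      Pi.single_apply]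
  refine ⟨ExteriorAlgebra.algebraMapInv.toLinearMap ∘ₗ
    CliffordAlgebra.contractLeft (Q := 0) (LinearMap.proj 3) ∘ₗ
    CliffordAlgebra.contractLeft (Q := 0) (LinearMap.proj 2) ∘ₗ
    CliffordAlgebra.contractLeft (Q := 0) (LinearMap.proj 1) ∘ₗ
    CliffordAlgebra.contractLeft (Q := 0) (LinearMap.proj 0), ?_⟩
  simp [d4x, mul_assoc, hc, h1]

/-- A functional with value one on `d4x`, applied to the second tensor factor, recovers the
coefficient. Conditions on Lagrangian forms thus become conditions on their coefficients. -/
theorem fourForm_injective :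
    Function.Injective (fourForm : FPoly U ι κ Zb Zf → HForm U ι κ Zb Zf) := by
  obtain ⟨φ, hφ⟩ := exists_dual_d4x
  intro f g h
  have h2 := congrArg
    ((TensorProduct.rid ℂ (FPoly U ι κ Zb Zf)).toLinearMap ∘ₗ TensorProduct.map LinearMap.id φ) h
  simpa [fourForm, hφ] using h2

theorem fourForm_add (f g : FPoly U ι κ Zb Zf) : fourForm (f + g) = fourForm f + fourForm g :=
  TensorProduct.add_tmul _ _ _

theorem fourForm_smul (c : ℂ) (f : FPoly U ι κ Zb Zf) : fourForm (c • f) = c • fourForm f := rfl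

theorem dH_threeForm (N : Fin 4 → FPoly U ι κ Zb Zf) :
    dH (threeForm N) = fourForm (∑ l, totalD l (N l)) := by
  have h : ∀ l m : Fin 4, (TensorProduct.map (totalD l) (LinearMap.mulLeft ℂ (dx l)))
      (N m ⊗ₜ[ℂ] dxLow m) = if l = m then fourForm (totalD l (N l)) else 0 := fun l m => by
    rw [TensorProduct.map_tmul, LinearMap.mulLeft_apply, dx_mul_dxLow]
    split_ifs with h
    · subst h; rfl
    · exact TensorProduct.tmul_zero _ _
  rw [dH, threeForm, LinearMap.sum_apply, fourForm, TensorProduct.sum_tmul]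
  refine Finset.sum_congr rfl fun l _ => ?_
  rw [map_sum, Finset.sum_congr rfl fun m _ => h l m]
  simp [fourForm]

theorem symmetricVia_iff {w : Fld ι κ → FPoly U ι κ Zb Zf} {ell : FPoly U ι κ Zb Zf}
    {N : Fin 4 → FPoly U ι κ Zb Zf} :
    SymmetricVia w ell N ↔ prolong w ell = ∑ l, totalD l (N l) := by
  rw [SymmetricVia, dH_threeForm]
  exact fourForm_injective.eq_iff

/-! ## Orders of fiber polynomials -/

theorem totalD_one (l : Fin 4) : totalD l (1 : FPoly U ι κ Zb Zf) = 0 :=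
  totalD_constants (one_mem _) l

theorem IsSuperDer.neg {b : Bool} {D : FPoly U ι κ Zb Zf →ₗ[ℂ] FPoly U ι κ Zb Zf}
    (hD : IsSuperDer b D) : IsSuperDer b (-D) where
  leibniz f g := by
    simp only [LinearMap.neg_apply, hD.leibniz, neg_add, neg_mul, mul_neg]
  parity f := by
    simp only [LinearMap.neg_apply, map_neg, hD.parity]
    cases b <;> rfl

/-- The commutator is a super-derivation of the same parity, so jet coordinates decide: `d_l y^j_M`
is the coordinate being differentiated exactly when `(j, M) = (i, Λ)`. -/
theorem pd_add_single_totalD (i : Fld ι κ) (Λ : MIdx) (l : Fin 4) (f : FPoly U ι κ Zb Zf) :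
    pd (i, Λ + Pi.single l 1) (totalD l f) =
      totalD l (pd (i, Λ + Pi.single l 1) f) + pd (i, Λ) f := by
  classical
  rw [(isSuperDer_totalD l).commutator_eq (isSuperDer_pd (i, Λ + Pi.single l 1))
    (isSuperDer_pd (i, Λ)).neg _ _ _ _ f, LinearMap.neg_apply, neg_add_cancel_right]
  · simp
  · simp
  · simp
  · intro j M
    have h : (j, M + Pi.single l 1) = (i, Λ + Pi.single l 1) ↔ (j, M) = (i, Λ) := by simp
    rw [totalD_jet, LinearMap.neg_apply, pd_jet, pd_jet, pd_jet, if_congr h rfl rfl,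
      add_neg_cancel]
    split_ifs
    exacts [totalD_one l, map_zero _]

theorem pd_totalD_of_eq_zero (i : Fld ι κ) {Λ : MIdx} {l : Fin 4} (hl : Λ l = 0)
    (f : FPoly U ι κ Zb Zf) : pd (i, Λ) (totalD l f) = totalD l (pd (i, Λ) f) := by
  classical
  refine (((isSuperDer_totalD l).commutator_eq (isSuperDer_pd (i, Λ))
    (IsSuperDer.zero _) (fun s => ?_) (fun z => ?_) (fun z => ?_) (fun j M => ?_) f).trans
      (add_zero _)).symm
  · simp
  · simp
  · simp
  · have h : (j, M + Pi.single l 1) ≠ (i, Λ) := fun h => by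
      have := congrFun (Prod.ext_iff.1 h).2 l
      simp [hl] at this
    rw [totalD_jet, LinearMap.zero_apply, pd_jet, pd_jet, if_neg h, add_zero]
    split_ifs
    exacts [totalD_one l, map_zero _]

theorem sum_add_single (Λ : MIdx) (l : Fin 4) :
    ∑ m, (Λ + Pi.single l 1 : MIdx) m = ∑ m, Λ m + 1 := by
  simp [Finset.sum_add_distrib]

theorem MIdx.eq_add_single {Λ : MIdx} {l : Fin 4} (hl : Λ l ≠ 0) :
    Λ = Λ - Pi.single l 1 + Pi.single l 1 := by
  ext m
  by_cases hm : m = l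
  · subst hm; simp; omega
  · simp [hm]

namespace HasOrder

variable {k n : ℕ} {f g : FPoly U ι κ Zb Zf}

theorem mono (hf : HasOrder k f) (h : k ≤ n) : HasOrder n f := fun i Λ hΛ => hf i Λ (h.trans_lt hΛ)
theorem zero : HasOrder k (0 : FPoly U ι κ Zb Zf) := fun _ _ _ => map_zero _
theorem add (hf : HasOrder k f) (hg : HasOrder k g) : HasOrder k (f + g) := fun i Λ h => by
  rw [map_add, hf i Λ h, hg i Λ h, add_zero]
theorem smul (c : ℂ) (hf : HasOrder k f) : HasOrder k (c • f) := fun i Λ h => by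
  rw [map_smul, hf i Λ h, smul_zero]
theorem sub (hf : HasOrder k f) (hg : HasOrder k g) : HasOrder k (f - g) := fun i Λ h => by
  rw [map_sub, hf i Λ h, hg i Λ h, sub_zero]
theorem sum {J : Type*} {s : Finset J} {F : J → FPoly U ι κ Zb Zf}
    (h : ∀ j ∈ s, HasOrder k (F j)) : HasOrder k (∑ j ∈ s, F j) :=
  Finset.sum_induction _ _ (fun _ _ => add) zero h
theorem mul (hf : HasOrder k f) (hg : HasOrder k g) : HasOrder k (f * g) := fun i Λ h => by
  rw [(isSuperDer_pd (i, Λ)).leibniz, hf i Λ h, hg i Λ h, zero_mul, mul_zero, add_zero]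
theorem coef (s : Smooth U) : HasOrder k (coef s : FPoly U ι κ Zb Zf) := fun _ _ _ => pd_coef _ _
theorem constants {θ : FPoly U ι κ Zb Zf} (hθ : θ ∈ constants U ι κ Zb Zf) : HasOrder k θ :=
  fun _ _ _ => pd_constants hθ _
theorem jet_zero (i : Fld ι κ) : HasOrder 0 (jet i 0 : FPoly U ι κ Zb Zf) := fun j Λ h => by
  classical
  rw [pd_jet, if_neg]
  rintro ⟨⟩
  simp at h
theorem totalD (hf : HasOrder k f) (l : Fin 4) : HasOrder (k + 1) (totalD l f) := fun i Λ h => by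
  by_cases hl : Λ l = 0
  · rw [pd_totalD_of_eq_zero i hl, hf i Λ (by omega), map_zero]
  · obtain ⟨M, rfl⟩ : ∃ M : MIdx, Λ = M + Pi.single l 1 := ⟨_, MIdx.eq_add_single hl⟩
    have h2 := sum_add_single M l
    rw [pd_add_single_totalD, hf i M (by omega), hf i (M + Pi.single l 1) (by omega), map_zero,
      add_zero]

end HasOrder

/-! ## The ghost Lagrangian -/

section Ghost

theorem sum_boson [Fintype ι] {M : Type*} [AddCommMonoid M] (F : Boson ι → M) :
    ∑ b, F b = ∑ l, ∑ I, F (.A l I) + ∑ I, F (.n I) := by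
  let e : (Fin 4 × ι) ⊕ ι ≃ Boson ι :=
    { toFun := Sum.elim (fun p => .A p.1 p.2) .n
      invFun := fun b => match b with
        | .A l I => .inl (l, I)
        | .n I => .inr I
      left_inv := by rintro (⟨l, I⟩ | I) <;> rfl
      right_inv := by rintro (⟨l, I⟩ | I) <;> rfl }
  rw [← e.sum_comp, Fintype.sum_sum_type, Fintype.sum_prod_type]
  rfl

theorem sum_fermion [Fintype ι] [Fintype κ] {M : Type*} [AddCommMonoid M]
    (F : Fermion ι κ → M) :
    ∑ b, F b = ∑ α, ∑ i, F (.psi α i) + ∑ α, ∑ i, F (.psiBar α i) + ∑ I, F (.omega I) +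
      ∑ I, F (.omegaBar I) := by
  let e : (((Fin 4 × κ) ⊕ (Fin 4 × κ)) ⊕ ι) ⊕ ι ≃ Fermion ι κ :=
    { toFun := Sum.elim (Sum.elim (Sum.elim (fun p => .psi p.1 p.2) (fun p => .psiBar p.1 p.2))
        .omega) .omegaBar
      invFun := fun b => match b with
        | .psi α i => .inl (.inl (.inl (α, i)))
        | .psiBar α i => .inl (.inl (.inr (α, i)))
        | .omega I => .inl (.inr I)
        | .omegaBar I => .inr I
      left_inv := by rintro (((⟨l, I⟩ | ⟨l, I⟩) | I) | I) <;> rfl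
      right_inv := by rintro (⟨l, I⟩ | ⟨l, I⟩ | I | I) <;> rfl }
  rw [← e.sum_comp, Fintype.sum_sum_type, Fintype.sum_sum_type, Fintype.sum_sum_type,
    Fintype.sum_prod_type, Fintype.sum_prod_type]
  rfl

theorem Background.gInv_symm (B : Background U) (l m : Fin 4) : B.gInv l m = B.gInv m l := by
  have h : ∀ x, (B.metric x)⁻¹ᵀ = (B.metric x)⁻¹ := fun x => by
    rw [Matrix.transpose_nonsing_inv, Background.metric, Matrix.transpose_mul,
      Matrix.transpose_mul, Matrix.transpose_transpose, minkowski, Matrix.diagonal_transpose,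
      Matrix.mul_assoc]
  refine Subtype.ext (funext fun x => ?_)
  change (((B.metric x)⁻¹ l m : ℝ) : ℂ) = (((B.metric x)⁻¹ m l : ℝ) : ℂ)
  rw [← h x, Matrix.transpose_apply, h x]

theorem Background.invSqrtG_mul_sqrtG (B : Background U) : B.invSqrtG * B.sqrtG = 1 := by
  refine Subtype.ext (funext fun x => ?_)
  change (((√|(B.metric x).det|)⁻¹ : ℝ) : ℂ) * ((√|(B.metric x).det| : ℝ) : ℂ) = 1
  rw [← Complex.ofReal_mul, inv_mul_cancel₀, Complex.ofReal_one]
  exact (Real.sqrt_pos.2 (abs_pos.2 (B.metric_det_ne x x.2))).ne'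

theorem hasOrder_gaugeFix (B : Background U) (ξ : ℝ) (I : ι) :
    HasOrder 1 (gaugeFix κ Zb Zf B ξ I) :=
  ((HasOrder.coef _).mul (HasOrder.sum fun l _ => (HasOrder.sum fun _ _ =>
    (HasOrder.coef _).mul (HasOrder.jet_zero _)).totalD l)).add
      (((HasOrder.jet_zero _).smul _).mono zero_le_one)

variable [Fintype ι] [DecidableEq ι] [Fintype κ]

theorem brst_fA (G : GaugeFrame ι κ) (l : Fin 4) (I : ι) :
    brst U Zb Zf G (fA U ι κ Zb Zf l I) = omCov G l I := brst_jet_zero G _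

theorem brst_fn (G : GaugeFrame ι κ) (I : ι) : brst U Zb Zf G (fn U ι κ Zb Zf I) = 0 :=
  brst_jet_zero G _

theorem brst_fomBar (G : GaugeFrame ι κ) (I : ι) :
    brst U Zb Zf G (fomBar U ι κ Zb Zf I) = fn U ι κ Zb Zf I := brst_jet_zero G _

theorem brst_omCov (G : GaugeFrame ι κ) (l : Fin 4) (I : ι) :
    brst U Zb Zf G (omCov G l I) = 0 := brst_vBrst G (.inl (.A l I))

theorem ellGhost_eq_antifield (B : Background U) (G : GaugeFrame ι κ) (ξ : ℝ) :
    ellGhost Zb Zf B G ξ = (∑ l, ∑ I, brst U Zb Zf G (fA U ι κ Zb Zf l I) *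
        antifield κ Zb Zf B ξ (.inl (.A l I)) +
      ∑ I, brst U Zb Zf G (fomBar U ι κ Zb Zf I) *
        antifield κ Zb Zf B ξ (.inr (.omegaBar I))) * coef B.sqrtG := by
  rw [ellGhost, Fintype.sum_sum_type, sum_boson, sum_fermion]
  simp only [antifield, mul_zero, Finset.sum_const_zero, add_zero, zero_add, vBrst, brst_fA,
    brst_fomBar]

theorem ellGhost_eq (B : Background U) (G : GaugeFrame ι κ) (ξ : ℝ) :
    ellGhost Zb Zf B G ξ = (∑ l, ∑ m, ∑ I, coef (B.gInv l m) *
        (totalD l (fomBar U ι κ Zb Zf I) * omCov G m I) +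
      ∑ I, fn U ι κ Zb Zf I * gaugeFix κ Zb Zf B ξ I) * coef B.sqrtG := by
  rw [ellGhost_eq_antifield]
  simp only [brst_fA, brst_fomBar, antifield]
  congr 2
  -- The two spacetime sums are exchanged so that the index of the derivative of `ω̄` comes first.
  rw [Finset.sum_comm (s := (Finset.univ : Finset (Fin 4))) (t := (Finset.univ : Finset (Fin 4)))]
  refine Finset.sum_congr rfl fun l _ => ?_
  rw [Finset.sum_comm]
  refine Finset.sum_congr rfl fun I _ => ?_
  rw [mul_neg, Finset.mul_sum, ← Finset.sum_neg_distrib]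
  refine Finset.sum_congr rfl fun m _ => ?_
  -- Exchanging the odd factors `ω_{;m}` and `ω̄_{,l}` produces a sign that cancels the one in the
  -- antifield of `A`.
  rw [(hasParity_omCov G l I).supercomm, twist_mul, twist_true, twist_true, parity_coef,
    hasParity_true.1 ((hasParity_fomBar I).totalD m), B.gInv_symm m l, mul_neg, neg_mul, neg_neg,
    mul_assoc]

theorem brst_gaugeF (B : Background U) (G : GaugeFrame ι κ) (I : ι) :
    brst U Zb Zf G (gaugeF κ Zb Zf B I) = coef B.invSqrtG *
      ∑ l, totalD l (∑ m, coef (B.gInv l m * B.sqrtG) * omCov G m I) := by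
  simp only [gaugeF, brst_coef_mul, map_sum (brst U Zb Zf G), brst_totalD, brst_fA]

/-- The minus sign is that of `S` passing `ω̄`. Only the `A`-part of the gauge fixing term varies,
as `S n = 0`, and its `1/√|g|` cancels the density. -/
theorem brst_kCoef (B : Background U) (G : GaugeFrame ι κ) (ξ : ℝ) :
    brst U Zb Zf G (kCoef κ Zb Zf B ξ) =
      (∑ I, fn U ι κ Zb Zf I * gaugeFix κ Zb Zf B ξ I) * coef B.sqrtG -
        ∑ I, ∑ l, fomBar U ι κ Zb Zf I *
          totalD l (∑ m, coef (B.gInv l m * B.sqrtG) * omCov G m I) := by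
  rw [kCoef, map_sum, Finset.sum_mul, ← Finset.sum_sub_distrib]
  refine Finset.sum_congr rfl fun I _ => ?_
  rw [brst_mul_coef, brst_mul, brst_fomBar, hasParity_true.1 (hasParity_fomBar I), gaugeFix,
    map_add, map_smul, brst_fn, smul_zero, add_zero, brst_gaugeF, add_mul, neg_mul, neg_mul,
    ← sub_eq_add_neg, ← Finset.mul_sum]
  congr 1
  rw [mul_assoc, coef_comm, mul_assoc, ← coef_mul, mul_comm B.invSqrtG]
  rw [← coef_comm, mul_comm B.sqrtG, B.invSqrtG_mul_sqrtG, coef_one, one_mul]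

/-- Product rule for `d_l`: the first sum is the kinetic term of the ghosts, the second the part
containing second derivatives, which is opposite to the one in `brst_kCoef`. -/
theorem sum_totalD_mCoef (B : Background U) (G : GaugeFrame ι κ) :
    ∑ l, totalD l (mCoef Zb Zf B G l) =
      (∑ l, ∑ m, ∑ I, coef (B.gInv l m) *
        (totalD l (fomBar U ι κ Zb Zf I) * omCov G m I)) * coef B.sqrtG +
        ∑ I, ∑ l, fomBar U ι κ Zb Zf I *
          totalD l (∑ m, coef (B.gInv l m * B.sqrtG) * omCov G m I) := by
  have hM : ∀ l, mCoef Zb Zf B G l = ∑ I, fomBar U ι κ Zb Zf I *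
      ∑ m, coef (B.gInv l m * B.sqrtG) * omCov G m I := fun l => by
    rw [mCoef, Finset.sum_comm]
    refine Finset.sum_congr rfl fun I _ => ?_
    rw [Finset.mul_sum]
    refine Finset.sum_congr rfl fun m _ => ?_
    rw [← mul_assoc, ← mul_assoc, coef_comm]
  simp only [hM]
  rw [Finset.sum_comm (s := (Finset.univ : Finset ι)), Finset.sum_mul, ← Finset.sum_add_distrib]
  refine Finset.sum_congr rfl fun l _ => ?_
  rw [map_sum, Finset.sum_comm, Finset.sum_mul, ← Finset.sum_add_distrib]
  refine Finset.sum_congr rfl fun I _ => ?_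
  rw [totalD_mul, Finset.mul_sum, Finset.sum_mul]
  congr 1
  refine Finset.sum_congr rfl fun m _ => ?_
  conv_rhs => rw [← coef_comm, ← mul_assoc, ← coef_mul, mul_comm B.sqrtG, ← mul_assoc, coef_comm]
  rw [← mul_assoc]

theorem ellGhost_eq_brst_add (B : Background U) (G : GaugeFrame ι κ) (ξ : ℝ) :
    ellGhost Zb Zf B G ξ = brst U Zb Zf G (kCoef κ Zb Zf B ξ) +
      ∑ l, totalD l (mCoef Zb Zf B G l) := by
  rw [ellGhost_eq, brst_kCoef, sum_totalD_mCoef, add_mul]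
  abel

/-! ### Orders of the Lagrangians -/

theorem hasOrder_omCov (G : GaugeFrame ι κ) (l : Fin 4) (I : ι) :
    HasOrder 1 (omCov G l I : FPoly U ι κ Zb Zf) :=
  ((HasOrder.jet_zero _).totalD l).add <| HasOrder.sum fun _ _ => HasOrder.sum fun _ _ =>
    (((HasOrder.jet_zero _).mul (HasOrder.jet_zero _)).smul _).mono zero_le_one

theorem hasOrder_mCoef (B : Background U) (G : GaugeFrame ι κ) (l : Fin 4) :
    HasOrder 1 (mCoef Zb Zf B G l) :=
  HasOrder.sum fun _ _ => HasOrder.sum fun _ _ => (HasOrder.coef _).mul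
    (((HasOrder.jet_zero _).mono zero_le_one).mul (hasOrder_omCov G _ _))

theorem hasOrder_ellGhost (B : Background U) (G : GaugeFrame ι κ) (ξ : ℝ) :
    HasOrder 1 (ellGhost Zb Zf B G ξ) := by
  rw [ellGhost_eq]
  exact ((HasOrder.sum fun l _ => HasOrder.sum fun _ _ => HasOrder.sum fun _ _ =>
    (HasOrder.coef _).mul (((HasOrder.jet_zero _).totalD l).mul (hasOrder_omCov G _ _))).add
      (HasOrder.sum fun _ _ => ((HasOrder.jet_zero _).mono zero_le_one).mul
        (hasOrder_gaugeFix B ξ _))).mul (HasOrder.coef _)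

theorem hasOrder_curv (G : GaugeFrame ι κ) (l m : Fin 4) (I : ι) :
    HasOrder 1 (curv Zb Zf U G l m I) :=
  (((HasOrder.jet_zero _).totalD m).sub ((HasOrder.jet_zero _).totalD l)).add <|
    HasOrder.sum fun _ _ => HasOrder.sum fun _ _ =>
      (((HasOrder.jet_zero _).mul (HasOrder.jet_zero _)).smul _).mono zero_le_one

theorem hasOrder_slashPsi (B : Background U) (G : GaugeFrame ι κ) (α : Fin 4) (i : κ) :
    HasOrder 1 (slashPsi Zb Zf B G α i) :=
  HasOrder.sum fun l _ => HasOrder.sum fun _ _ => (HasOrder.coef _).mul <|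
    (((HasOrder.jet_zero _).totalD l).sub (HasOrder.sum fun _ _ =>
      ((HasOrder.coef _).mul (HasOrder.jet_zero _)).mono zero_le_one)).sub <|
        HasOrder.sum fun _ _ => HasOrder.sum fun _ _ =>
          (((HasOrder.jet_zero _).mul (HasOrder.jet_zero _)).smul _).mono zero_le_one

theorem hasOrder_slashPsiBar (B : Background U) (G : GaugeFrame ι κ) (α : Fin 4) (i : κ) :
    HasOrder 1 (slashPsiBar Zb Zf B G α i) :=
  HasOrder.sum fun l _ => HasOrder.sum fun _ _ => HasOrder.mul
    ((((HasOrder.jet_zero _).totalD l).add (HasOrder.sum fun _ _ =>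
      ((HasOrder.jet_zero _).mul (HasOrder.coef _)).mono zero_le_one)).add <|
        HasOrder.sum fun _ _ => HasOrder.sum fun _ _ =>
          (((HasOrder.jet_zero _).mul (HasOrder.jet_zero _)).smul _).mono zero_le_one)
    (HasOrder.coef _)

theorem hasOrder_ell0 (B : Background U) (G : GaugeFrame ι κ) (mass : ℝ) :
    HasOrder 1 (ell0 Zb Zf B G mass) := by
  have h0 : ∀ i : Fld ι κ, HasOrder 1 (jet i 0 : FPoly U ι κ Zb Zf) := fun i =>
    (HasOrder.jet_zero i).mono zero_le_one
  refine HasOrder.add (HasOrder.mul ?_ (HasOrder.coef _)) ?_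
  · exact HasOrder.sum fun _ _ => HasOrder.sum fun _ _ =>
      ((((h0 _).mul (hasOrder_slashPsi B G _ _)).sub
        ((hasOrder_slashPsiBar B G _ _).mul (h0 _))).smul _).sub (((h0 _).mul (h0 _)).smul _)
  · exact (HasOrder.sum fun _ _ => HasOrder.sum fun _ _ => HasOrder.sum fun _ _ =>
      HasOrder.sum fun _ _ => HasOrder.sum fun _ _ => (HasOrder.coef _).mul
        ((hasOrder_curv G _ _ _).mul (hasOrder_curv G _ _ _))).smul _

/-- A prolongation along a first-order field could raise the order to two. It does not here:
`ω_{;m}` is `S`-closed, so `S` only replaces `ω̄` by `n`. -/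
theorem hasOrder_brst_mCoef (B : Background U) (G : GaugeFrame ι κ) (l : Fin 4) :
    HasOrder 1 (brst U Zb Zf G (mCoef Zb Zf B G l)) := by
  have h : ∀ m I, brst U Zb Zf G (fomBar U ι κ Zb Zf I * omCov G m I) =
      fn U ι κ Zb Zf I * omCov G m I := fun m I => by
    rw [brst_mul, brst_omCov, mul_zero, add_zero, brst_fomBar]
  simp only [mCoef, map_sum, brst_coef_mul, h]
  exact HasOrder.sum fun _ _ => HasOrder.sum fun _ _ => (HasOrder.coef _).mul
    (((HasOrder.jet_zero _).mono zero_le_one).mul (hasOrder_omCov G _ _))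

end Ghost

/-! ## Noether currents -/

theorem midx_nil : midx [] = 0 := rfl

theorem midx_cons (l : Fin 4) (L : List (Fin 4)) : midx (l :: L) = midx L + Pi.single l 1 := by
  ext m
  by_cases h : m = l
  · simp [midx, h]
  · simp [midx, h, List.count_cons_of_ne (Ne.symm h)]

theorem sum_midx (L : List (Fin 4)) : ∑ l, midx L l = L.length := by
  induction L with
  | nil => simp [midx_nil]
  | cons l L ih => rw [midx_cons, sum_add_single, ih, List.length_cons]

theorem HasOrder.symPd_eq_zero {k : ℕ} {f : FPoly U ι κ Zb Zf} (hf : HasOrder k f) (i : Fld ι κ)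
    {L : List (Fin 4)} (hL : k < L.length) : symPd i L f = 0 := by
  rw [symPd, hf i _ (by rwa [sum_midx]), smul_zero]

theorem symPd_add (i : Fld ι κ) (L : List (Fin 4)) (f g : FPoly U ι κ Zb Zf) :
    symPd i L (f + g) = symPd i L f + symPd i L g := by
  rw [symPd, map_add, smul_add]; rfl

theorem symPd_smul (i : Fld ι κ) (L : List (Fin 4)) (c : ℂ) (f : FPoly U ι κ Zb Zf) :
    symPd i L (c • f) = c • symPd i L f := by
  rw [symPd, map_smul, smul_comm]; rfl

theorem symPd_singleton (i : Fld ι κ) (l : Fin 4) (f : FPoly U ι κ Zb Zf) :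
    symPd i [l] f = pd (i, Pi.single l 1) f := by
  have h : ∏ m : Fin 4, (([l] : List (Fin 4)).count m).factorial = 1 := by
    fin_cases l <;> rfl
  have h2 : (∏ m : Fin 4, ((([l] : List (Fin 4)).count m).factorial : ℂ)) = 1 := by
    exact_mod_cast h
  rw [symPd, h2, midx_cons, midx_nil, zero_add]
  simp

/-- The weight `Λ!/2!` is one on the diagonal and one half off it, where two sequences share the
same multi-index. -/
theorem symPd_pair (i : Fld ι κ) (l m : Fin 4) (f : FPoly U ι κ Zb Zf) :
    symPd i [l, m] f =
      (if l = m then 1 else 1 / 2 : ℂ) • pd (i, Pi.single m 1 + Pi.single l 1) f := by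
  have h : ∏ n : Fin 4, (([l, m] : List (Fin 4)).count n).factorial = if l = m then 2 else 1 := by
    fin_cases l <;> fin_cases m <;> rfl
  have h2 : (∏ n : Fin 4, ((([l, m] : List (Fin 4)).count n).factorial : ℂ)) =
      if l = m then 2 else 1 := by exact_mod_cast h
  rw [symPd, h2, midx_cons, midx_cons, midx_nil, zero_add]
  congr 1
  split_ifs <;> simp

section Current

variable [Fintype ι] [Fintype κ]

theorem noetherP_add (k : ℕ) (v : Fld ι κ → FPoly U ι κ Zb Zf) (f g : FPoly U ι κ Zb Zf)
    (l : Fin 4) : noetherP k v (f + g) l = noetherP k v f l + noetherP k v g l := by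
  simp only [noetherP, symPd_add, map_add, mul_add, Finset.sum_add_distrib]

theorem noetherP_smul (k : ℕ) (v : Fld ι κ → FPoly U ι κ Zb Zf) (c : ℂ) (f : FPoly U ι κ Zb Zf)
    (l : Fin 4) : noetherP k v (c • f) l = c • noetherP k v f l := by
  simp only [noetherP, symPd_smul, map_smul, mul_smul_comm, Finset.smul_sum]

/-- The additional terms have `p + r = k`, so they contain derivatives of `f` with respect to jets
of order `k + 1`, which vanish. -/
theorem noetherP_succ {k : ℕ} {f : FPoly U ι κ Zb Zf} (hf : HasOrder k f)
    (v : Fld ι κ → FPoly U ι κ Zb Zf) (l : Fin 4) :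
    noetherP (k + 1) v f l = noetherP k v f l := by
  have h0 : ∀ p r, k = p + r → ∑ m : Fin p → Fin 4, ∑ s : Fin r → Fin 4, ∑ i,
      dMulti (midx (List.ofFn m)) (v i) * ((-1) ^ r *
        dMulti (midx (List.ofFn s)) (symPd i (l :: (List.ofFn m ++ List.ofFn s)) f)) = 0 :=
    fun p r h => Finset.sum_eq_zero fun m _ => Finset.sum_eq_zero fun s _ =>
      Finset.sum_eq_zero fun i _ => by
        rw [hf.symPd_eq_zero i (by simp [h]), map_zero, mul_zero, mul_zero]
  -- The new terms are `p = k` with `r = 0`, and one term `r = k - p` for each smaller `p`.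
  rw [noetherP, Finset.sum_range_succ, Nat.add_sub_cancel_left, Finset.sum_range_one,
    h0 k 0 rfl, add_zero, noetherP]
  refine Finset.sum_congr rfl fun p hp => ?_
  have hp' := Finset.mem_range.1 hp
  rw [Nat.succ_sub hp'.le, Finset.sum_range_succ, h0 p (k - p) (by omega), add_zero]

theorem noetherP_of_le {n k : ℕ} (h : n ≤ k) {f : FPoly U ι κ Zb Zf} (hf : HasOrder n f)
    (v : Fld ι κ → FPoly U ι κ Zb Zf) (l : Fin 4) : noetherP k v f l = noetherP n v f l := by
  induction k, h using Nat.le_induction with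
  | base => rfl
  | succ k hk ih => rw [noetherP_succ (hf.mono hk), ih]

theorem noetherP_two (v : Fld ι κ → FPoly U ι κ Zb Zf) (f : FPoly U ι κ Zb Zf) (l : Fin 4) :
    noetherP 2 v f l = ∑ i, (v i * symPd i [l] f - ∑ m, v i * totalD m (symPd i [l, m] f) +
      ∑ m, totalD m (v i) * symPd i [l, m] f) := by
  have h1 : ∀ F : (Fin 1 → Fin 4) → FPoly U ι κ Zb Zf, ∑ s, F s = ∑ m, F fun _ => m := fun F =>
    ((Equiv.funUnique (Fin 1) (Fin 4)).symm.sum_comp F).symm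
  have hm : ∀ m : Fin 4, midx [m] = Pi.single m 1 := fun m => by
    rw [midx_cons, midx_nil, zero_add]
  rw [noetherP, Finset.sum_range_succ, Finset.sum_range_one, Nat.sub_zero, Finset.sum_range_succ,
    Finset.sum_range_one, Finset.sum_range_one]
  simp only [h1, Fintype.sum_unique, List.ofFn_zero, List.ofFn_succ, midx_nil, dMulti_zero, hm,
    dMulti_single, pow_zero, one_mul, pow_one, List.nil_append, List.append_nil, neg_mul, mul_neg]
  rw [Finset.sum_add_distrib, Finset.sum_sub_distrib,
    Finset.sum_comm (s := (Finset.univ : Finset (Fin 4))),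
    Finset.sum_comm (s := (Finset.univ : Finset (Fin 4)))]
  simp only [Finset.sum_neg_distrib, sub_eq_add_neg]

/-- The prolongation on fiber polynomials of order one. -/
theorem prolong_of_hasOrder_one (v : Fld ι κ → FPoly U ι κ Zb Zf) {f : FPoly U ι κ Zb Zf}
    (hf : HasOrder 1 f) : prolong v f =
      ∑ i, (v i * pd (i, 0) f + ∑ m, totalD m (v i) * pd (i, Pi.single m 1) f) := by
  classical
  -- `Option (Fin 4)` enumerates the multi-indices of order at most one, with `none` for the zero
  -- multi-index.
  have hinj : Function.Injective fun p : Fld ι κ × Option (Fin 4) =>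
      ((p.1, p.2.elim 0 fun m => Pi.single m 1) : Fld ι κ × MIdx) := by
    rintro ⟨i, m⟩ ⟨j, n⟩ h
    obtain ⟨rfl, h⟩ := Prod.ext_iff.1 h
    cases m <;> cases n
    · rfl
    · simp [Pi.single_eq_zero_iff, eq_comm] at h
    · simp [Pi.single_eq_zero_iff] at h
    · rename_i m n
      have := congrFun h m
      simp [Pi.single_apply] at this
      rw [this]
  rw [prolong, vert_apply, finsum_eq_sum_of_support_subset (s := Finset.univ.map ⟨_, hinj⟩),
    Finset.sum_map, Fintype.sum_prod_type]
  · simp only [Fintype.sum_option, Function.Embedding.coeFn_mk, Option.elim, dMulti_zero,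
      dMulti_single]
  · rintro ⟨i, Λ⟩ hp
    have hΛ : ∑ l, Λ l ≤ 1 := by
      by_contra h
      exact hp (by simp only [hf i Λ (not_le.1 h), mul_zero])
    simp only [Finset.coe_map, Finset.coe_univ, Set.image_univ, Set.mem_range]
    by_cases h0 : Λ = 0
    · exact ⟨(i, none), by rw [h0]; rfl⟩
    · obtain ⟨m, hm⟩ := Function.ne_iff.1 h0
      obtain ⟨M, rfl⟩ : ∃ M : MIdx, Λ = M + Pi.single m 1 := ⟨_, MIdx.eq_add_single hm⟩
      rw [sum_add_single] at hΛ
      have hM : M = 0 := funext fun l =>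
        Finset.sum_eq_zero_iff.1 (Nat.le_zero.1 (Nat.le_of_succ_le_succ hΛ)) l (Finset.mem_univ l)
      exact ⟨(i, some m), by rw [hM, zero_add]; rfl⟩

/-- The contribution of a total divergence `d_n M^n` to the Noether current is `δ[v] M^l`, provided
that the derivatives `∂_i^m M^l` are symmetric in `l` and `m`. -/
theorem noetherP_two_divergence (v : Fld ι κ → FPoly U ι κ Zb Zf)
    {M : Fin 4 → FPoly U ι κ Zb Zf} (hM : ∀ l, HasOrder 1 (M l))
    (hsymm : ∀ i l m, pd (i, Pi.single m 1) (M l) = pd (i, Pi.single l 1) (M m)) (l : Fin 4) :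
    noetherP 2 v (∑ n, totalD n (M n)) l = prolong v (M l) := by
  have h2 : ∀ i (l m n : Fin 4), pd (i, Pi.single m 1 + Pi.single l 1) (M n) = 0 :=
    fun i l m n => hM n i _ (by rw [sum_add_single]; simp)
  -- Only `n = l` and `n = m` contribute. For `l ≠ m` the result is half of `∂_i^m M^l + ∂_i^l M^m`,
  -- and symmetry makes the two halves equal; on the diagonal there is one term of weight one.
  have hpair : ∀ i m, symPd i [l, m] (∑ n, totalD n (M n)) = pd (i, Pi.single m 1) (M l) := by
    intro i m
    rw [symPd_pair, map_sum]
    by_cases hlm : l = m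
    · subst hlm
      rw [if_pos rfl, one_smul, Finset.sum_eq_single l, pd_add_single_totalD, h2, map_zero,
        zero_add]
      · intro n _ hn
        rw [pd_totalD_of_eq_zero, h2, map_zero]
        simp [hn]
      · exact fun h => absurd (Finset.mem_univ l) h
    · have hne : ∀ n, n ≠ l → n ≠ m → (Pi.single m 1 + Pi.single l 1 : MIdx) n = 0 :=
        fun n h1 h2 => by simp [h1, h2]
      rw [if_neg hlm, Finset.sum_eq_add l m hlm (fun n _ hn => by
          rw [pd_totalD_of_eq_zero _ (hne n hn.1 hn.2), h2, map_zero])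
          (fun h => absurd (Finset.mem_univ l) h) (fun h => absurd (Finset.mem_univ m) h),
        pd_add_single_totalD, h2, map_zero, zero_add, add_comm (Pi.single m 1 : MIdx),
        pd_add_single_totalD, h2, map_zero, zero_add, hsymm i m l, ← two_smul ℂ, smul_smul]
      norm_num
  -- By symmetry the first-order derivative contains `d_n ∂_i^n M^l`, which is precisely what the
  -- divergence of the second-order derivatives subtracts.
  have hone : ∀ i, symPd i [l] (∑ n, totalD n (M n)) =
      ∑ n, totalD n (pd (i, Pi.single n 1) (M l)) + pd (i, 0) (M l) := by
    intro i
    have h3 : ∀ n, pd (i, Pi.single l 1) (totalD n (M n)) =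
        totalD n (pd (i, Pi.single l 1) (M n)) + if n = l then pd (i, 0) (M l) else 0 := by
      intro n
      split_ifs with h
      · subst h
        simpa using pd_add_single_totalD i 0 n (M n)
      · rw [pd_totalD_of_eq_zero _ (by simp [h]), add_zero]
    rw [symPd_singleton, map_sum, Finset.sum_congr rfl fun n _ => h3 n, Finset.sum_add_distrib]
    simp [hsymm i _ l]
  rw [noetherP_two, prolong_of_hasOrder_one v (hM l)]
  refine Finset.sum_congr rfl fun i _ => ?_
  -- After this cancellation there remains `v^i ∂_i M^l + d_m v^i ∂_i^m M^l`, the prolongation of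
  -- `v` acting on a first-order `M^l`.
  simp only [hpair, hone, mul_add, Finset.mul_sum]
  abel

theorem noetherP_divergence {k : ℕ} (hk : 2 ≤ k) (v : Fld ι κ → FPoly U ι κ Zb Zf)
    {M : Fin 4 → FPoly U ι κ Zb Zf} (hM : ∀ l, HasOrder 1 (M l))
    (hsymm : ∀ i l m, pd (i, Pi.single m 1) (M l) = pd (i, Pi.single l 1) (M m)) (l : Fin 4) :
    noetherP k v (∑ n, totalD n (M n)) l = prolong v (M l) := by
  rw [noetherP_of_le hk (HasOrder.sum fun n _ => (hM n).totalD n),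
    noetherP_two_divergence v hM hsymm]

variable [DecidableEq ι]

theorem pd_single_omCov (G : GaugeFrame ι κ) (i : Fld ι κ) (m n : Fin 4) (I : ι) :
    pd (i, Pi.single m 1) (omCov G n I : FPoly U ι κ Zb Zf) =
      if n = m then pd (i, 0) (fom U ι κ Zb Zf I) else 0 := by
  have h0 : ∀ j : Fld ι κ, pd (i, Pi.single m 1) (jet j 0 : FPoly U ι κ Zb Zf) = 0 := fun j =>
    HasOrder.jet_zero j i _ (by simp)
  have h1 : ∀ J, pd (i, Pi.single m 1) (fom U ι κ Zb Zf J) = 0 := fun J => h0 _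
  have h2 : ∀ J, pd (i, Pi.single m 1) (fA U ι κ Zb Zf n J) = 0 := fun J => h0 _
  simp only [omCov, map_add, map_sum, map_smul, (isSuperDer_pd _).leibniz, h1, h2, zero_mul,
    mul_zero, add_zero, smul_zero, Finset.sum_const_zero]
  split_ifs with h
  · subst h
    have := pd_add_single_totalD i 0 n (fom U ι κ Zb Zf I)
    rwa [zero_add, h1, map_zero, zero_add] at this
  · rw [pd_totalD_of_eq_zero _ (by simp [h]), h1, map_zero]

/-- First derivatives enter `𝓜` only through `ω_{,m}`, with coefficient `g^{lm} √|g| ω̄_I` up to the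
sign from passing `ω̄_I`. The symmetry is that of the inverse metric. -/
theorem pd_single_mCoef_symm (B : Background U) (G : GaugeFrame ι κ) (i : Fld ι κ)
    (l m : Fin 4) : pd (i, Pi.single m 1) (mCoef Zb Zf B G l) =
      pd (i, Pi.single l 1) (mCoef Zb Zf B G m) := by
  have h : ∀ l m, pd (i, Pi.single m 1) (mCoef Zb Zf B G l) =
      ∑ I, coef (B.gInv l m * B.sqrtG) *
        (twist i.isRight (fomBar U ι κ Zb Zf I) * pd (i, 0) (fom U ι κ Zb Zf I)) := by
    intro l m
    have h1 : ∀ I, pd (i, Pi.single m 1) (fomBar U ι κ Zb Zf I) = 0 := fun I =>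
      HasOrder.jet_zero (.inr (.omegaBar I)) i _ (by simp)
    have h2 : ∀ s : Smooth U, twist i.isRight (coef s : FPoly U ι κ Zb Zf) = coef s := fun s => by
      cases i.isRight
      exacts [rfl, parity_coef s]
    simp only [mCoef, map_sum, (isSuperDer_pd _).leibniz, pd_coef, h1, h2, zero_mul, zero_add,
      pd_single_omCov]
    rw [Finset.sum_comm]
    refine Finset.sum_congr rfl fun I _ => ?_
    rw [Finset.sum_eq_single m, if_pos rfl]
    · intro n _ hn
      rw [if_neg hn, mul_zero, mul_zero]
    · simp
  rw [h, h]
  simp only [B.gInv_symm]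

/-- Adding a multiple of `d_H 𝓜` to a Lagrangian. -/
theorem symmetry_add_divergence (B : Background U) (G : GaugeFrame ι κ)
    {w : Fld ι κ → FPoly U ι κ Zb Zf}
    (hw : ∀ l f, prolong w (totalD l f) = totalD l (prolong w f)) {c : ℂ} {k : ℕ} (hk : 2 ≤ k)
    {ell ell' : FPoly U ι κ Zb Zf} (h : ell' = ell + c • ∑ l, totalD l (mCoef Zb Zf B G l))
    {N : Fin 4 → FPoly U ι κ Zb Zf} (hN : SymmetricVia w ell N) :
    SymmetricVia w ell' (fun l => N l + c • prolong w (mCoef Zb Zf B G l)) ∧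
      current k w ell' (fun l => N l + c • prolong w (mCoef Zb Zf B G l)) =
        current k w ell N := by
  constructor
  · rw [symmetricVia_iff] at hN ⊢
    rw [h, map_add, hN, map_smul, map_sum]
    simp only [hw, map_add, map_smul, Finset.sum_add_distrib, Finset.smul_sum]
  · refine congrArg threeForm (funext fun l => ?_)
    rw [h, noetherP_add, noetherP_smul,
      noetherP_divergence hk w (hasOrder_mCoef B G) (pd_single_mCoef_symm B G),
      add_sub_add_right_eq_sub]

/-- One implication suffices for the equivalence, since `c` is arbitrary and may be replaced by
`-c`. -/
theorem isSymmetry_of_add_divergence (B : Background U) (G : GaugeFrame ι κ)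
    {w : Fld ι κ → FPoly U ι κ Zb Zf}
    (hw : ∀ l f, prolong w (totalD l f) = totalD l (prolong w f))
    (hwM : ∀ l, HasOrder 1 (prolong w (mCoef Zb Zf B G l))) {c : ℂ} {k : ℕ} (hk : 2 ≤ k)
    {ell ell' : FPoly U ι κ Zb Zf} (h : ell' = ell + c • ∑ l, totalD l (mCoef Zb Zf B G l))
    (hs : IsSymmetry k w ell) : IsSymmetry k w ell' := by
  obtain ⟨N, hN, hNs⟩ := hs
  exact ⟨_, fun l => (hN l).add (((hwM l).smul c).mono (by omega)),
    (symmetry_add_divergence B G hw hk h hNs).1⟩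

end Current

end BRST

end

/-! ### The main theorem. -/

open BRST

theorem mainTheorem3 {ι κ Zb Zf : Type} [Fintype ι] [DecidableEq ι] [Fintype κ]
    (U : TopologicalSpace.Opens BRST.Pt) (B : BRST.Background U) (G : BRST.GaugeFrame ι κ)
    (mass ξ : ℝ) :
    -- `S` is the anti-derivation determined by `v̆`
    ((∀ f g : BRST.FPoly U ι κ Zb Zf, BRST.brst U Zb Zf G (f * g) =
        BRST.brst U Zb Zf G f * g + BRST.parity f * BRST.brst U Zb Zf G g) ∧
      (∀ f : BRST.FPoly U ι κ Zb Zf,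
        BRST.parity (BRST.brst U Zb Zf G f) = -BRST.brst U Zb Zf G (BRST.parity f)) ∧
      (∀ s : BRST.Smooth U, BRST.brst U Zb Zf G (BRST.coef s) = 0) ∧
      (∀ i : BRST.Fld ι κ,
        BRST.brst U Zb Zf G (BRST.jet i 0) = BRST.vBrst U Zb Zf G i) ∧
      (∀ (l : Fin 4) (f : BRST.FPoly U ι κ Zb Zf), BRST.brst U Zb Zf G (BRST.totalD l f) =
        BRST.totalD l (BRST.brst U Zb Zf G f)) ∧
      (∀ θ ∈ BRST.constants U ι κ Zb Zf, BRST.parity θ = -θ →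
        ∀ α : BRST.HForm U ι κ Zb Zf, BRST.delta (fun i => θ * BRST.vBrst U Zb Zf G i) α =
          BRST.mulForm θ (BRST.brstForm U Zb Zf G α))) ∧
    -- `S² = 0`
    (∀ f : BRST.FPoly U ι κ Zb Zf, BRST.brst U Zb Zf G (BRST.brst U Zb Zf G f) = 0) ∧
    (∀ α : BRST.HForm U ι κ Zb Zf,
      BRST.brstForm U Zb Zf G (BRST.brstForm U Zb Zf G α) = 0) ∧
    -- `S 𝓛₀ = 0`
    BRST.brstForm U Zb Zf G (BRST.fourForm (BRST.ell0 Zb Zf B G mass)) = 0 ∧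
    -- the ghost Lagrangian
    BRST.fourForm (BRST.ellGhost Zb Zf B G ξ) = BRST.fourForm
      ((∑ l, ∑ I, BRST.brst U Zb Zf G (BRST.fA U ι κ Zb Zf l I) *
            BRST.antifield κ Zb Zf B ξ (.inl (.A l I)) +
          ∑ I, BRST.brst U Zb Zf G (BRST.fomBar U ι κ Zb Zf I) *
            BRST.antifield κ Zb Zf B ξ (.inr (.omegaBar I))) * BRST.coef B.sqrtG) ∧
    BRST.fourForm (BRST.ellGhost Zb Zf B G ξ) = BRST.fourForm
      ((∑ l, ∑ m, ∑ I, BRST.coef (B.gInv l m) *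
            (BRST.totalD l (BRST.fomBar U ι κ Zb Zf I) * BRST.omCov G m I) +
          ∑ I, BRST.fn U ι κ Zb Zf I * BRST.gaugeFix κ Zb Zf B ξ I) * BRST.coef B.sqrtG) ∧
    BRST.fourForm (BRST.ellGhost Zb Zf B G ξ) =
      BRST.brstForm U Zb Zf G (BRST.fourForm (BRST.kCoef κ Zb Zf B ξ)) +
        BRST.dH (BRST.threeForm (BRST.mCoef Zb Zf B G)) ∧
    -- adding a multiple of `d_H 𝓜` changes neither the invariance nor the current;
    -- `w` is `v = θ v̆` with `θ` odd, or `v̆` itself (that is, with `θ` eliminated)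
    (∀ w : BRST.Fld ι κ → BRST.FPoly U ι κ Zb Zf,
      (w = BRST.vBrst U Zb Zf G ∨ ∃ θ ∈ BRST.constants U ι κ Zb Zf, BRST.parity θ = -θ ∧
        w = fun i => θ * BRST.vBrst U Zb Zf G i) →
      (∀ (c : ℂ) (k : ℕ), 2 ≤ k → ∀ ell ell' : BRST.FPoly U ι κ Zb Zf, BRST.HasOrder k ell →
        BRST.fourForm ell' =
          BRST.fourForm ell + c • BRST.dH (BRST.threeForm (BRST.mCoef Zb Zf B G)) →
        BRST.HasOrder k ell' ∧
        (BRST.IsSymmetry k w ell ↔ BRST.IsSymmetry k w ell') ∧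
        ∀ N : Fin 4 → BRST.FPoly U ι κ Zb Zf, BRST.SymmetricVia w ell N →
          BRST.SymmetricVia w ell'
            (fun l => N l + c • BRST.prolong w (BRST.mCoef Zb Zf B G l)) ∧
          BRST.current k w ell'
              (fun l => N l + c • BRST.prolong w (BRST.mCoef Zb Zf B G l)) =
            BRST.current k w ell N) ∧
      -- in particular `𝓛₀ + 𝓛_ghost` (of order one) and `𝓛₀ + S 𝓚` (of order two) are both
      -- BRST-invariant, with the same current
      BRST.HasOrder 1 (BRST.ell0 Zb Zf B G mass + BRST.ellGhost Zb Zf B G ξ) ∧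
      BRST.HasOrder 2 (BRST.ell0 Zb Zf B G mass +
        BRST.brst U Zb Zf G (BRST.kCoef κ Zb Zf B ξ)) ∧
      (∀ l, BRST.HasOrder 1 (BRST.prolong w (BRST.mCoef Zb Zf B G l))) ∧
      BRST.SymmetricVia w (BRST.ell0 Zb Zf B G mass + BRST.ellGhost Zb Zf B G ξ)
        (fun l => BRST.prolong w (BRST.mCoef Zb Zf B G l)) ∧
      BRST.SymmetricVia w (BRST.ell0 Zb Zf B G mass +
        BRST.brst U Zb Zf G (BRST.kCoef κ Zb Zf B ξ)) 0 ∧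
      BRST.current 1 w (BRST.ell0 Zb Zf B G mass + BRST.ellGhost Zb Zf B G ξ)
          (fun l => BRST.prolong w (BRST.mCoef Zb Zf B G l)) =
        BRST.current 2 w (BRST.ell0 Zb Zf B G mass +
          BRST.brst U Zb Zf G (BRST.kCoef κ Zb Zf B ξ)) 0) := by
  have hcomp : ∀ (v w : Fld ι κ → FPoly U ι κ Zb Zf) (α : HForm U ι κ Zb Zf),
      delta v (delta w α) = TensorProduct.map (prolong v ∘ₗ prolong w) LinearMap.id α :=
    fun v w α => by
      rw [delta, delta, ← LinearMap.comp_apply, ← TensorProduct.map_comp, LinearMap.comp_id]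
  refine ⟨⟨brst_mul G, fun f => (isSuperDer_brst G).parity f, brst_coef G, brst_jet_zero G,
    brst_totalD G, ?_⟩, brst_brst G, ?_, ?_, ?_, ?_, ?_, ?_⟩
  · intro θ hθ _ α
    induction α using TensorProduct.induction_on with
    | zero => exact (LinearMap.map_zero _).trans (LinearMap.map_zero _).symm
    | add x y hx hy => rw [LinearMap.map_add, LinearMap.map_add, LinearMap.map_add, hx, hy]
    | tmul f τ =>
      change prolong _ f ⊗ₜ[ℂ] τ = (θ * brst U Zb Zf G f) ⊗ₜ[ℂ] τ
      rw [prolong_constants_mul hθ]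
      rfl
  · intro α
    have h : prolong (vBrst U Zb Zf G) ∘ₗ prolong (vBrst U Zb Zf G) = 0 :=
      LinearMap.ext fun f => brst_brst G f
    rw [brstForm, hcomp, h, TensorProduct.map_zero_left, LinearMap.zero_apply]
  · exact (congrArg fourForm (brst_ell0 B G mass)).trans (TensorProduct.zero_tmul _ _)
  · exact congrArg fourForm (ellGhost_eq_antifield B G ξ)
  · exact congrArg fourForm (ellGhost_eq B G ξ)
  · rw [ellGhost_eq_brst_add B G, dH_threeForm, fourForm_add]
    rfl
  · intro w hw
    -- Both choices of `w` are handled together: eliminating `θ` amounts to taking the constant `1`.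
    have hS : ∃ θ : FPoly U ι κ Zb Zf, θ ∈ constants U ι κ Zb Zf ∧
        ∀ f, prolong w f = θ * brst U Zb Zf G f := by
      rcases hw with rfl | ⟨θ, hθ, -, rfl⟩
      · exact ⟨1, one_mem _, fun f => (one_mul _).symm⟩
      · exact ⟨θ, hθ, prolong_constants_mul hθ _⟩
    obtain ⟨θ, hθ, hS⟩ := hS
    have hcomm : ∀ l f, prolong w (totalD l f) = totalD l (prolong w f) := fun l f => by
      rw [hS, hS, brst_totalD, totalD_mul, totalD_constants hθ, zero_mul, zero_add]
    have hwM : ∀ l, HasOrder 1 (prolong w (mCoef Zb Zf B G l)) := fun l => by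
      rw [hS]
      exact (HasOrder.constants hθ).mul (hasOrder_brst_mCoef B G l)
    -- Here `S 𝓛₀ = 0` and `S² = 0` give exact invariance, with no divergence term.
    have hSK : SymmetricVia w (ell0 Zb Zf B G mass + brst U Zb Zf G (kCoef κ Zb Zf B ξ)) 0 := by
      rw [symmetricVia_iff, hS, map_add, brst_ell0, brst_brst, add_zero, mul_zero]
      simp only [Pi.zero_apply, map_zero, Finset.sum_const_zero]
    have hsum : ell0 Zb Zf B G mass + ellGhost Zb Zf B G ξ =
        ell0 Zb Zf B G mass + brst U Zb Zf G (kCoef κ Zb Zf B ξ) +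
          (1 : ℂ) • ∑ l, totalD l (mCoef Zb Zf B G l) := by
      rw [one_smul, ellGhost_eq_brst_add B G, add_assoc]
    have hord : HasOrder 1 (ell0 Zb Zf B G mass + ellGhost Zb Zf B G ξ) :=
      (hasOrder_ell0 B G mass).add (hasOrder_ellGhost B G ξ)
    have hdM : HasOrder 2 (∑ l, totalD l (mCoef Zb Zf B G l)) :=
      HasOrder.sum fun l _ => (hasOrder_mCoef B G l).totalD l
    -- The ghost Lagrangian is reached from `S 𝓚` by taking `c = 1`, `k = 2` and `N = 0`.
    have hres := symmetry_add_divergence B G hcomm le_rfl hsum hSK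
    simp only [Pi.zero_apply, zero_add, one_smul] at hres
    refine ⟨?_, hord, ?_, hwM, hres.1, hSK, ?_⟩
    · intro c k hk ell ell' hell h
      rw [dH_threeForm, ← fourForm_smul, ← fourForm_add] at h
      have h' := fourForm_injective h
      have h2 : ell = ell' + (-c) • ∑ l, totalD l (mCoef Zb Zf B G l) := by
        rw [h', neg_smul, add_neg_cancel_right]
      refine ⟨?_, ⟨isSymmetry_of_add_divergence B G hcomm hwM hk h',
        isSymmetry_of_add_divergence B G hcomm hwM hk h2⟩,
        fun N hN => symmetry_add_divergence B G hcomm hk h' hN⟩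
      rw [h']
      exact hell.add ((hdM.mono hk).smul c)
    -- The order of `𝓛₀ + S 𝓚` is read off as a first-order Lagrangian minus the divergence of
    -- first-order components.
    · have h2 : ell0 Zb Zf B G mass + brst U Zb Zf G (kCoef κ Zb Zf B ξ) =
          ell0 Zb Zf B G mass + ellGhost Zb Zf B G ξ - ∑ l, totalD l (mCoef Zb Zf B G l) := by
        rw [hsum, one_smul, add_sub_cancel_right]
      rw [h2]
      exact (hord.mono one_le_two).sub hdM
    -- The comparison of currents was made with `k = 2`; for a first-order Lagrangian the expression
    -- with `k = 1` is the same.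
    · rw [← hres.2]
      exact congrArg threeForm (funext fun l => by
        rw [noetherP_of_le one_le_two hord])
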